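/- Let $\mathbb S=\mathbb P^1(\mathbb C)$. **Trees of spheres.** Let $X$ be a finite set with at least $3$ elements. A tree of spheres $\mathcal T$ marked by $X$ consists of a finite combinatorial tree $T$ whose leaves are the elements of $X$ and whose internal vertices have valence at least $3$; for each internal vertex $v$, a topological sphere $\mathbb S_v$ with a projective structure; and for each internal vertex $v$ an injection $i_v:E_v\to\mathbb S_v$ of the set $E_v$ of edges at $v$. Put $X_v:=i_v(E_v)$ and let $a_v:X\to\mathbb S_v$ send $x$ to $i_v(e)$, where $e\in E_v$ is the first edge of the path from $v$ to $x$. An isomorphism $\mathcal T\to\mathcal T'$ is an isomorphism of combinatorial trees that is the identity on $X$, together with projective isomorphisms between the corresponding spheres that respect the attaching points $i_v(e)$. Let $\overline{\mathbf{Mod}}_X$ be the set of isomorphism classes. For a triple $t=(x_0,x_1,x_\infty)$ of distinct elements of $X$ let $v$ be the internal vertex separating it, let $\sigma_t:\mathbb S_v\to\mathbb S$ be the projective chart with $\sigma_t(a_v(x_0))=0$, $\sigma_t(a_v(x_1))=1$, $\sigma_t(a_v(x_\infty))=\infty$, and put $\alpha_t:=\sigma_t\circ a_v$. The topology of $\overline{\mathbf{Mod}}_X$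 is the one induced by the map $\mathfrak B:\overline{\mathbf{Mod}}_X\to\mathbb S^{\mathrm{Quad}_X}$, $[\mathcal T]\mapsto(\alpha_t(x))_{(t,x)}$, where $\mathrm{Quad}_X$ is the set of quadruples $(t,x)$ of distinct elements of $X$. **Covers.** Let $Y,Z$ be finite sets with at least $3$ elements. A portrait $\mathbf F=(F,\deg)$ of degree $d\ge 2$ is a map $F:Y\to Z$ and a function $\deg:Y\to\mathbb N\setminus\{0\}$ with $\sum_{a\in Y}(\deg(a)-1)=2d-2$ and $\sum_{a\in F^{-1}(b)}\deg(a)=d$ for all $b\in Z$. A cover $\mathcal F:\mathcal T^Y\to\mathcal T^Z$ between trees of spheres marked by $Y$ and $Z$ is a map $F:T^Y\to T^Z$ sending leaves to leaves, internal vertices to internal vertices and edges to edges, and, for each internal vertex $v$ with $w=F(v)$, a holomorphic ramified cover $f_v:\mathbb S_v\to\mathbb S_w$ such that $f_v:\mathbb S_v\setminus Y_v\to\mathbb S_w\setminus Z_w$ is a cover, $f_v\circ i_v=i_w\circ F$, and for each edge $e=\{v,v'\}$ between internal vertices the local degrees of $f_v$ at $i_v(e)$ and of $f_{v'}$ at $i_{v'}(e)$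 agree. Its portrait is $(F|_Y,\deg|_Y)$, where $\deg(y)$ is the local degree of $f_v$ at the attaching point of the edge joining the leaf $y$ to its neighbour $v$. Let $\overline{\mathbf{Rev}}_{\mathbf F}$ be the set of covers with portrait $\mathbf F$. An isomorphism between two covers is a pair of isomorphisms of trees of spheres, between the sources and between the targets, that commute with the tree maps and with the maps $f_v$. Let $\overline{\mathbf{rev}}_{\mathbf F}$ be the set of isomorphism classes, and let $\mathbf I:\overline{\mathbf{rev}}_{\mathbf F}\to\overline{\mathbf{Mod}}_Y$ send $[\mathcal F:\mathcal T^Y\to\mathcal T^Z]$ to $[\mathcal T^Y]$. Give $\overline{\mathbf{rev}}_{\mathbf F}$ the topology induced by $\mathbf I$. A marked sphere cover with portrait $\mathbf F$ is an element of $\overline{\mathbf{Rev}}_{\mathbf F}$ whose two trees each have a unique internal vertex; we write it $(f,a^Y,a^Z)$ with $f:\mathbb S^Y\to\mathbb S^Z$ and markings $a^Y:Y\to\mathbb S^Y$, $a^Z:Z\to\mathbb S^Z$. **Convergence.** A sequence of marked sphere covers $f_n=(f_n,a^Y_n,a^Z_n)$, $f_n:\mathbb S_n^Y\to\mathbb S_n^Z$,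 with portrait $\mathbf F$ converges to $\mathcal F\in\overline{\mathbf{Rev}}_{\mathbf F}$, written $f_n\to\mathcal F$, if there are projective isomorphisms $\phi^Y_{n,v}:\mathbb S^Y_n\to\mathbb S_v$ and $\phi^Z_{n,w}:\mathbb S^Z_n\to\mathbb S_w$, for all $n$ and all internal vertices $v$ of $T^Y$ and $w$ of $T^Z$, such that for every internal vertex $v$ of $T^Y$ and $w=F(v)$: $\phi^Y_{n,v}\circ a^Y_n\to a^Y_v$, $\phi^Z_{n,w}\circ a^Z_n\to a^Z_w$, and $\phi^Z_{n,w}\circ f_n\circ(\phi^Y_{n,v})^{-1}\to f_v$ locally uniformly on $\mathbb S_v\setminus Y_v$. **Statement.** The topology given by $\mathbf I$ is compatible with this notion of convergence: for every sequence $(f_n)$ of marked sphere covers with portrait $\mathbf F$ and every $\mathcal F\in\overline{\mathbf{Rev}}_{\mathbf F}$, $$f_n\to\mathcal F\iff [f_n]\to[\mathcal F]\ \text{in}\ \overline{\mathbf{rev}}_{\mathbf F},\qquad\text{and}\qquad f_n\to\mathcal F\iff \mathbf I([f_n])\to\mathbf I([\mathcal F])\ \text{in}\ \overline{\mathbf{Mod}}_Y.$$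 -/

import Mathlib

open Set Filter Topology

universe u v w

namespace SphereTrees

noncomputable section

/-! ### The Riemann sphere and holomorphic maps -/

/-- The Riemann sphere `ℙ¹(ℂ)`. -/
abbrev RSphere : Type := OnePoint ℂ

/-- Standard parametrization of a neighbourhood of `x ∈ ℙ¹(ℂ)` by a complex variable, sending `0`
to `x`: `t ↦ x + t` if `x` is finite, and `t ↦ 1 / t` if `x = ∞`. -/
def param : RSphere → ℂ → RSphere
  | OnePoint.some x, t => ((x + t : ℂ) : OnePoint ℂ)
  | OnePoint.infty, t => if t = 0 then OnePoint.infty else ((t⁻¹ : ℂ) : OnePoint ℂ)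

/-- Standard coordinate near `x ∈ ℙ¹(ℂ)`, sending `x` to `0`: `y ↦ y - x` if `x` is finite, and
`y ↦ 1 / y` (so `∞ ↦ 0`) if `x = ∞`. Away from `x` the value at the pole is irrelevant. -/
def coord : RSphere → RSphere → ℂ
  | OnePoint.some x, OnePoint.some y => y - x
  | OnePoint.some _, OnePoint.infty => 0
  | OnePoint.infty, OnePoint.some y => y⁻¹
  | OnePoint.infty, OnePoint.infty => 0

/-- The map `f : ℙ¹(ℂ) → ℙ¹(ℂ)` read in the standard coordinates near `x` and near `f x`. -/
def localRep (f : RSphere → RSphere) (x : RSphere) (t : ℂ) : ℂ := coord (f x) (f (param x t))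

/-- Holomorphic maps from the Riemann sphere to itself. -/
def IsHolo (f : RSphere → RSphere) : Prop :=
  Continuous f ∧ ∀ x, AnalyticAt ℂ (localRep f x) 0

/-- The local degree at `x` of a (nonconstant) holomorphic map: the order of vanishing of
`f - f x` in local coordinates. -/
def localDeg (f : RSphere → RSphere) (x : RSphere) : ℕ := analyticOrderNatAt (localRep f x) 0

/-! ### Topological spheres with a projective structure -/

/-- A topological sphere with a projective structure, given by its global projective charts: the
homeomorphisms to `ℙ¹(ℂ)` that are compatible with the structure. They form one orbit under
post-composition by Moebius transformations. -/
structure ProjSphere where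
  carrier : Type w
  [top : TopologicalSpace carrier]
  charts : Set (carrier ≃ₜ RSphere)
  charts_nonempty : charts.Nonempty
  mem_charts_iff : ∀ σ ∈ charts, ∀ τ : carrier ≃ₜ RSphere,
    τ ∈ charts ↔ ∃ g : Matrix.GeneralLinearGroup (Fin 2) ℂ, ∀ x, τ x = g • σ x

instance : CoeSort ProjSphere.{w} (Type w) := ⟨ProjSphere.carrier⟩

instance (S : ProjSphere.{w}) : TopologicalSpace S := S.top

/-- Some projective chart. -/
def ProjSphere.chart (S : ProjSphere.{w}) : S ≃ₜ RSphere := S.charts_nonempty.some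

instance (S : ProjSphere.{w}) : CompactSpace S := S.chart.symm.compactSpace

instance (S : ProjSphere.{w}) : T2Space S := S.chart.isEmbedding.t2Space

variable {S S' S'' : ProjSphere.{w}}

/-- Projective isomorphisms: homeomorphisms that pull projective charts back to projective
charts. -/
def IsProjIso (m : S ≃ₜ S') : Prop := ∀ σ ∈ S'.charts, m.trans σ ∈ S.charts

/-- Holomorphic maps between spheres with a projective structure. -/
def IsHolomorphic (f : S → S') : Prop :=
  ∀ σ ∈ S.charts, ∀ τ ∈ S'.charts, IsHolo (fun x => τ (f (σ.symm x)))

/-- The local degree at `x` of a holomorphic map (it does not depend on the charts). -/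
def localDegree (f : S → S') (x : S) : ℕ :=
  localDeg (fun y => S'.chart (f (S.chart.symm y))) (S.chart x)

/-- Locally uniform convergence on the set `U` of a sequence of maps, for the unique uniform
structure of the compact Hausdorff space `S'`. -/
def LocallyUniformLimit (f : ℕ → S → S') (g : S → S') (U : Set S) : Prop :=
  @TendstoLocallyUniformlyOn S S' ℕ _ uniformSpaceOfCompactR1 f g atTop U

/-! ### Trees of spheres -/

/-- A (projective) tree of spheres marked by `X`. The vertices of the combinatorial tree are the
leaves `Sum.inl x`, for `x ∈ X`, and the internal vertices `Sum.inr v`. The edges adjacent to a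
vertex are indexed by the neighbours of that vertex. -/
structure TreeOfSpheres (X : Type u) where
  /-- the internal vertices -/
  IV : Type v
  finite_IV : Finite IV
  graph : SimpleGraph (X ⊕ IV)
  isTree : graph.IsTree
  leaf : ∀ x, (graph.neighborSet (Sum.inl x)).ncard = 1
  stable : ∀ v, 3 ≤ (graph.neighborSet (Sum.inr v)).ncard
  sphere : IV → ProjSphere.{w}
  /-- the attaching points of the edges, the injection `i_v : E_v → 𝕊_v` -/
  attach : ∀ v, graph.neighborSet (Sum.inr v) → sphere v
  attach_injective : ∀ v, Function.Injective (attach v)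

namespace TreeOfSpheres

variable {X : Type u}

/-- The path from the internal vertex `v` to the leaf `x`. -/
def path (T : TreeOfSpheres.{u, v, w} X) (v : T.IV) (x : X) :
    T.graph.Walk (Sum.inr v) (Sum.inl x) :=
  (T.isTree.existsUnique_path (Sum.inr v) (Sum.inl x)).choose

theorem path_isPath (T : TreeOfSpheres.{u, v, w} X) (v : T.IV) (x : X) : (T.path v x).IsPath :=
  (T.isTree.existsUnique_path (Sum.inr v) (Sum.inl x)).choose_spec.1

/-- The first edge of the path from `v` to the leaf `x`, that is, the edge at `v` that lies in the
same connected component as `x` once `v` is removed. -/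
def toward (T : TreeOfSpheres.{u, v, w} X) (v : T.IV) (x : X) :
    T.graph.neighborSet (Sum.inr v) :=
  ⟨(T.path v x).snd, (T.path v x).adj_snd (SimpleGraph.Walk.not_nil_of_ne Sum.inr_ne_inl)⟩

/-- The map `a_v : X → 𝕊_v`. -/
def a (T : TreeOfSpheres.{u, v, w} X) (v : T.IV) (x : X) : T.sphere v :=
  T.attach v (T.toward v x)

/-- The set `X_v = i_v(E_v)` of attaching points on `𝕊_v`. -/
def attachSet (T : TreeOfSpheres.{u, v, w} X) (v : T.IV) : Set (T.sphere v) :=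
  range (T.attach v)

end TreeOfSpheres

variable {X : Type u}

/-- Isomorphisms of trees of spheres marked by `X`: an isomorphism of combinatorial trees that is
the identity on `X`, and for each internal vertex `v`, with image `v'`, a projective isomorphism
`𝕊_v → 𝕊_{v'}` that respects the attaching points of the edges. -/
structure TreeIso (T T' : TreeOfSpheres.{u, v, w} X) where
  vertex : T.IV ≃ T'.IV
  adj_iff : ∀ a b, T'.graph.Adj (Sum.map id vertex a) (Sum.map id vertex b) ↔ T.graph.Adj a b
  map : ∀ v v', vertex v = v' → (T.sphere v ≃ₜ T'.sphere v')
  isProjIso : ∀ v v' h, IsProjIso (map v v' h)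
  map_attach : ∀ v v' h (e : T.graph.neighborSet (Sum.inr v))
    (e' : T'.graph.neighborSet (Sum.inr v')),
    e'.1 = Sum.map id vertex e.1 → map v v' h (T.attach v e) = T'.attach v' e'

namespace TreeIso

variable {T T' T'' : TreeOfSpheres.{u, v, w} X}

theorem isProjIso_symm {m : S ≃ₜ S'} (h : IsProjIso m) : IsProjIso m.symm := by
  intro σ hσ
  obtain ⟨g, hg⟩ := (S.mem_charts_iff _ (h _ S'.charts_nonempty.some_mem) σ).1 hσ
  refine (S'.mem_charts_iff _ S'.charts_nonempty.some_mem _).2 ⟨g, fun x => ?_⟩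
  simpa using hg (m.symm x)

/-- The identity. -/
def refl (T : TreeOfSpheres.{u, v, w} X) : TreeIso T T where
  vertex := Equiv.refl _
  adj_iff a b := by simp
  map v v' h := by
    cases h
    exact Homeomorph.refl _
  isProjIso := by
    rintro v _ rfl σ hσ
    exact hσ
  map_attach := by
    rintro v _ rfl e e' h
    have : e' = e := Subtype.ext (by simpa using h)
    subst this
    rfl

/-- The inverse isomorphism. -/
def symm (M : TreeIso T T') : TreeIso T' T where
  vertex := M.vertex.symm
  adj_iff a b := by
    rw [← M.adj_iff]
    simp
  map v v' h := (M.map v' v (by simp [← h])).symm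
  isProjIso v v' h := isProjIso_symm (M.isProjIso _ _ _)
  map_attach v v' h e e' he := by
    rw [Homeomorph.symm_apply_eq]
    symm
    apply M.map_attach
    simp [he]

/-- Composition of isomorphisms. -/
def trans (M : TreeIso T T') (M' : TreeIso T' T'') : TreeIso T T'' where
  vertex := M.vertex.trans M'.vertex
  adj_iff a b := by
    rw [← M.adj_iff, ← M'.adj_iff]
    simp
  map v v' h := (M.map v _ rfl).trans (M'.map _ v' h)
  isProjIso v v' h σ hσ := M.isProjIso _ _ _ _ (M'.isProjIso _ _ _ _ hσ)
  map_attach v v' h e e' he := by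
    have hadj : T'.graph.Adj (Sum.inr (M.vertex v)) (Sum.map id M.vertex e.1) :=
      (M.adj_iff (Sum.inr v) e.1).2 e.2
    rw [Homeomorph.trans_apply, M.map_attach v _ rfl e ⟨_, hadj⟩ rfl]
    apply M'.map_attach
    simp [he]

theorem map_a (M : TreeIso T T') (v : T.IV) (v' : T'.IV) (h : M.vertex v = v') (x : X) :
    M.map v v' h (T.a v x) = T'.a v' x := by
  subst h
  refine M.map_attach _ _ _ _ _ ?_
  let φ : T.graph →g T'.graph := ⟨Sum.map id M.vertex, fun {a b} h => (M.adj_iff a b).2 h⟩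
  have hφ : Function.Injective φ := Sum.map_injective.2 ⟨Function.injective_id, M.vertex.injective⟩
  have h1 : ((T.path v x).map φ).IsPath :=
    (T.path_isPath v x).map hφ
  have h2 := (T'.isTree.existsUnique_path _ _).unique (T'.path_isPath (M.vertex v) x) h1
  change (T'.path (M.vertex v) x).snd = φ (T.path v x).snd
  rw [h2]
  exact SimpleGraph.Walk.getVert_map _ _ _

end TreeIso

/-- Isomorphism of trees of spheres marked by `X`. -/
instance treeSetoid (X : Type u) : Setoid (TreeOfSpheres.{u, v, w} X) where
  r T T' := Nonempty (TreeIso T T')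
  iseqv := ⟨fun T => ⟨TreeIso.refl T⟩, fun ⟨M⟩ => ⟨M.symm⟩, fun ⟨M⟩ ⟨M'⟩ => ⟨M.trans M'⟩⟩

/-- The moduli space of trees of spheres marked by `X`. -/
def ModBar (X : Type u) : Type (max u (v + 1) (w + 1)) :=
  Quotient (treeSetoid.{u, v, w} X)

/-- The chart `σ` of `𝕊_v` is the `t`-chart of `T` for the triple `t = (x₀, x₁, x_∞)`. In
particular `v` is the vertex that separates the triple. -/
def IsTChart (T : TreeOfSpheres.{u, v, w} X) (x₀ x₁ xi : X) (v : T.IV)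
    (σ : T.sphere v ≃ₜ RSphere) : Prop :=
  σ ∈ (T.sphere v).charts ∧ σ (T.a v x₀) = ((0 : ℂ) : OnePoint ℂ) ∧
    σ (T.a v x₁) = ((1 : ℂ) : OnePoint ℂ) ∧ σ (T.a v xi) = OnePoint.infty

/-- The value at `x` of the marking `α_t = σ_t ∘ a_v` of the `t`-chart of `T`, for a triple
`t = (x₀, x₁, x_∞)` of distinct elements. It is the only `s` with the stated property, since the
separating vertex and the `t`-chart exist and are unique. -/
def tMarking (T : TreeOfSpheres.{u, v, w} X) (x₀ x₁ xi x : X) : RSphere :=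
  Classical.epsilon fun s => ∃ v σ, IsTChart T x₀ x₁ xi v σ ∧ σ (T.a v x) = s

/-- Quadruples of distinct elements of `X`. -/
def Quad (X : Type u) : Type u := {q : Fin 4 → X // Function.Injective q}

theorem exists_tChart_of_iso {T T' : TreeOfSpheres.{u, v, w} X} (M : TreeIso T T')
    {x₀ x₁ xi x : X} {s : RSphere}
    (h : ∃ v σ, IsTChart T x₀ x₁ xi v σ ∧ σ (T.a v x) = s) :
    ∃ v σ, IsTChart T' x₀ x₁ xi v σ ∧ σ (T'.a v x) = s := by
  obtain ⟨v, σ, ⟨hσ, h0, h1, hi⟩, hs⟩ := h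
  refine ⟨M.vertex v, (M.map v _ rfl).symm.trans σ,
    ⟨M.symm.isProjIso (M.vertex v) v (by simp [TreeIso.symm]) σ hσ, ?_, ?_, ?_⟩, ?_⟩ <;>
  simpa [← M.map_a v _ rfl]

theorem tMarking_eq_of_iso {T T' : TreeOfSpheres.{u, v, w} X} (M : TreeIso T T')
    (x₀ x₁ xi x : X) : tMarking T x₀ x₁ xi x = tMarking T' x₀ x₁ xi x := by
  unfold tMarking
  congr 1
  funext s
  exact propext ⟨exists_tChart_of_iso M, exists_tChart_of_iso M.symm⟩

/-- The map `𝔅` from the moduli space of trees of spheres to `𝕊 ^ Quad_X`, which maps the class of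
`T` to the collection of the `α_t(x)`, for `(t, x) ∈ Quad_X`. -/
def crossRatios (X : Type u) : ModBar.{u, v, w} X → (Quad X → RSphere) :=
  Quotient.lift (fun T q => tMarking T (q.1 0) (q.1 1) (q.1 2) (q.1 3))
    (fun _ _ ⟨M⟩ => funext fun _ => tMarking_eq_of_iso M _ _ _ _)

/-- The topology on the moduli space of trees of spheres, defined by `𝔅`. -/
instance (X : Type u) : TopologicalSpace (ModBar.{u, v, w} X) :=
  TopologicalSpace.induced (crossRatios X) inferInstance

/-! ### Portraits and covers between trees of spheres -/

variable {Y Z : Type u}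

/-- A portrait of degree `d ≥ 2`. -/
structure Portrait (Y Z : Type u) [Fintype Y] [DecidableEq Z] where
  d : ℕ
  two_le_d : 2 ≤ d
  F : Y → Z
  deg : Y → ℕ
  deg_pos : ∀ y, 0 < deg y
  sum_deg_sub_one : ∑ y, (deg y - 1) = 2 * d - 2
  sum_fiber : ∀ z, ∑ y with F y = z, deg y = d

/-- A (holomorphic) cover between trees of spheres. -/
structure Cover (TY : TreeOfSpheres.{u, v, w} Y) (TZ : TreeOfSpheres.{u, v, w} Z) where
  leafMap : Y → Z
  vertexMap : TY.IV → TZ.IV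
  /-- edges are mapped to edges -/
  adj : ∀ {a b}, TY.graph.Adj a b →
    TZ.graph.Adj (Sum.map leafMap vertexMap a) (Sum.map leafMap vertexMap b)
  /-- the maps `f_v : 𝕊_v → 𝕊_{F(v)}` -/
  map : ∀ v, TY.sphere v → TZ.sphere (vertexMap v)
  holomorphic : ∀ v, IsHolomorphic (map v)
  nonconstant : ∀ v, ∃ x y, map v x ≠ map v y
  /-- `f_v : 𝕊_v - Y_v → 𝕊_{F(v)} - Z_{F(v)}` is a cover -/
  covering : ∀ v, ∃ h : MapsTo (map v) (TY.attachSet v)ᶜ (TZ.attachSet (vertexMap v))ᶜ,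
    IsCoveringMap h.restrict
  map_attach : ∀ v (e : TY.graph.neighborSet (Sum.inr v)),
    map v (TY.attach v e) =
      TZ.attach (vertexMap v) ⟨Sum.map leafMap vertexMap e.1, adj e.2⟩
  edge_degree : ∀ v v' (h : TY.graph.Adj (Sum.inr v) (Sum.inr v')),
    localDegree (map v) (TY.attach v ⟨Sum.inr v', h⟩) =
      localDegree (map v') (TY.attach v' ⟨Sum.inr v, h.symm⟩)

variable [Fintype Y] [DecidableEq Z]

/-- The portrait of a cover is `P`: it is given by the restriction to the leaves of the tree map,
and the degree of a leaf is the local degree at the attaching point of its edge. -/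
def Cover.HasPortrait {TY : TreeOfSpheres.{u, v, w} Y} {TZ : TreeOfSpheres.{u, v, w} Z}
    (f : Cover TY TZ) (P : Portrait Y Z) : Prop :=
  f.leafMap = P.F ∧ ∀ y v (h : TY.graph.Adj (Sum.inr v) (Sum.inl y)),
    localDegree (f.map v) (TY.attach v ⟨Sum.inl y, h⟩) = P.deg y

/-- Covers between trees of spheres with portrait `P`. -/
structure MarkedCover (P : Portrait Y Z) where
  source : TreeOfSpheres.{u, v, w} Y
  target : TreeOfSpheres.{u, v, w} Z
  cover : Cover source target
  hasPortrait : cover.HasPortrait P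

variable {P : Portrait Y Z}

/-- Isomorphisms between covers: pairs of isomorphisms of trees of spheres that commute with the
tree maps and with the maps between spheres. -/
structure CoverIso (C C' : MarkedCover.{u, v, w} P) where
  source : TreeIso C.source C'.source
  target : TreeIso C.target C'.target
  vertex_comm : ∀ v, target.vertex (C.cover.vertexMap v) = C'.cover.vertexMap (source.vertex v)
  map_comm : ∀ v v' (h : source.vertex v = v')
    (h' : target.vertex (C.cover.vertexMap v) = C'.cover.vertexMap v') x,
    C'.cover.map v' (source.map v v' h x) = target.map _ _ h' (C.cover.map v x)

namespace CoverIso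

variable {C C' C'' : MarkedCover.{u, v, w} P}

/-- The identity. -/
def refl (C : MarkedCover.{u, v, w} P) : CoverIso C C where
  source := TreeIso.refl _
  target := TreeIso.refl _
  vertex_comm v := rfl
  map_comm := by
    rintro v _ rfl h x
    rfl

/-- The inverse isomorphism. -/
def symm (M : CoverIso C C') : CoverIso C' C where
  source := M.source.symm
  target := M.target.symm
  vertex_comm v := by
    have := M.vertex_comm (M.source.vertex.symm v)
    rw [Equiv.apply_symm_apply] at this
    exact (Equiv.symm_apply_eq _).2 this.symm
  map_comm v v' h h' x := by
    have h1 : M.source.vertex v' = v := ((Equiv.symm_apply_eq _).1 h).symm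
    have h2 : M.target.vertex (C.cover.vertexMap v') = C'.cover.vertexMap v :=
      ((Equiv.symm_apply_eq _).1 h').symm
    change C.cover.map v' ((M.source.map v' v h1).symm x) =
      (M.target.map _ _ h2).symm (C'.cover.map v x)
    rw [eq_comm, Homeomorph.symm_apply_eq, ← M.map_comm v' v h1 h2, Homeomorph.apply_symm_apply]

/-- Composition of isomorphisms. -/
def trans (M : CoverIso C C') (M' : CoverIso C' C'') : CoverIso C C'' where
  source := M.source.trans M'.source
  target := M.target.trans M'.target
  vertex_comm v := by
    change M'.target.vertex (M.target.vertex _) = _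
    rw [M.vertex_comm, M'.vertex_comm]
    rfl
  map_comm v v' h h' x := by
    have key : ∀ w1 (hw : M.target.vertex (C.cover.vertexMap v) = w1)
        (hw' : M'.target.vertex w1 = C''.cover.vertexMap v') y,
        M'.target.map w1 _ hw' (M.target.map _ w1 hw y) =
        M'.target.map _ _ h' (M.target.map _ _ rfl y) := by
      rintro _ rfl hw' y
      rfl
    change C''.cover.map v' (M'.source.map _ v' h (M.source.map v _ rfl x)) =
      M'.target.map _ _ h' (M.target.map _ _ rfl (C.cover.map v x))
    rw [M'.map_comm _ v' h ((M.vertex_comm v).symm ▸ h'), M.map_comm v _ rfl (M.vertex_comm v)]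
    exact key _ _ _ _

end CoverIso

/-- Isomorphism of covers between trees of spheres. -/
instance coverSetoid (P : Portrait Y Z) : Setoid (MarkedCover.{u, v, w} P) where
  r C C' := Nonempty (CoverIso C C')
  iseqv := ⟨fun C => ⟨CoverIso.refl C⟩, fun ⟨M⟩ => ⟨M.symm⟩, fun ⟨M⟩ ⟨M'⟩ => ⟨M.trans M'⟩⟩

/-- The set of isomorphism classes of covers between trees of spheres with portrait `P`. -/
def RevBar (P : Portrait Y Z) : Type (max u (v + 1) (w + 1)) :=
  Quotient (coverSetoid.{u, v, w} P)

/-- The isomorphism class of a cover. -/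
def MarkedCover.cls (C : MarkedCover.{u, v, w} P) : RevBar.{u, v, w} P := Quotient.mk _ C

namespace RevBar

/-- The map `[I]`, which maps the class of a cover to the classes of its source and target. -/
def sourceTarget : RevBar.{u, v, w} P → ModBar.{u, v, w} Y × ModBar.{u, v, w} Z :=
  Quotient.lift (fun C => (Quotient.mk _ C.source, Quotient.mk _ C.target))
    (fun _ _ ⟨M⟩ => Prod.ext (Quotient.sound ⟨M.source⟩) (Quotient.sound ⟨M.target⟩))

/-- The map `𝐈`, which maps the class of a cover to the class of its source. -/
def I (c : RevBar.{u, v, w} P) : ModBar.{u, v, w} Y := (sourceTarget c).1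

/-- The topology on the set of isomorphism classes of covers, defined by `𝐈`. -/
instance : TopologicalSpace (RevBar.{u, v, w} P) := TopologicalSpace.induced I inferInstance

end RevBar

/-- Marked sphere covers with portrait `P`: covers between two trees of spheres that both have a
unique internal vertex. -/
structure SphereCover (P : Portrait Y Z) extends MarkedCover.{u, v, w} P where
  center : source.IV
  source_unique : ∀ v, v = center
  target_unique : ∀ v, v = cover.vertexMap center

namespace SphereCover

/-- The source sphere `𝕊^Y`. -/
def sphereY (f : SphereCover.{u, v, w} P) : ProjSphere.{w} := f.source.sphere f.center

/-- The target sphere `𝕊^Z`. -/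
def sphereZ (f : SphereCover.{u, v, w} P) : ProjSphere.{w} :=
  f.target.sphere (f.cover.vertexMap f.center)

/-- The marking `a^Y : Y → 𝕊^Y`. -/
def aY (f : SphereCover.{u, v, w} P) (y : Y) : f.sphereY := f.source.a f.center y

/-- The marking `a^Z : Z → 𝕊^Z`. -/
def aZ (f : SphereCover.{u, v, w} P) (z : Z) : f.sphereZ :=
  f.target.a (f.cover.vertexMap f.center) z

/-- The map `𝕊^Y → 𝕊^Z`. -/
def map (f : SphereCover.{u, v, w} P) : f.sphereY → f.sphereZ := f.cover.map f.center

end SphereCover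

/-- (Non dynamical) convergence of a sequence of marked sphere covers with portrait `P` to a cover
between trees of spheres with portrait `P`. -/
def ConvergesTo (f : ℕ → SphereCover.{u, v, w} P) (C : MarkedCover.{u, v, w} P) : Prop :=
  ∃ (φY : ∀ n (v : C.source.IV), (f n).sphereY ≃ₜ C.source.sphere v)
    (φZ : ∀ n (v : C.target.IV), (f n).sphereZ ≃ₜ C.target.sphere v),
    (∀ n v, IsProjIso (φY n v)) ∧ (∀ n v, IsProjIso (φZ n v)) ∧
    ∀ v : C.source.IV,
      (∀ y, Tendsto (fun n => φY n v ((f n).aY y)) atTop (𝓝 (C.source.a v y))) ∧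
      (∀ z, Tendsto (fun n => φZ n (C.cover.vertexMap v) ((f n).aZ z)) atTop
        (𝓝 (C.target.a (C.cover.vertexMap v) z))) ∧
      LocallyUniformLimit
        (fun n x => φZ n (C.cover.vertexMap v) ((f n).map ((φY n v).symm x)))
        (C.cover.map v) (C.source.attachSet v)ᶜ

end

end SphereTrees

namespace SphereTrees

noncomputable section

section

/-! ### Homogeneous coordinates and Moebius transformations -/

/-! The topology of `RevBar` is induced by `I`, so both equivalences amount to one: convergence of
covers is the same as convergence of the classes of their sources.

Convergence of covers gives convergence of cross-ratios. At the vertex separating a triple, the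
normalized chart of the n-th source differs from the limiting chart read through `φY` by a Moebius
map that moves `0`, `1`, `∞` to points tending to `0`, `1`, `∞`. Such maps tend to the identity
(`tendsto_of_tendsto_smul`), so the normalized markings have the same limit.

For the converse, choose a separating triple at each internal vertex of both limit trees, and let
`φY` and `φZ` match the charts normalized by these triples. The source markings then converge by
hypothesis, and the target markings of the three chosen leaves are constant. It remains to recover
the maps and the other target markings, and this is where rationality enters. A holomorphic map
between spheres is determined, up to a constant factor, by its zeros and poles (`IsHolo.eq_prod`, a
Liouville argument). For a sphere cover these are the marked points above two leaves `z₀` and `z₁`,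
with the multiplicities of the portrait. When the marked points collide onto the attaching points of
`𝕊_v`, the multiplicities add up, zeros against poles. The limit of these divisors is the divisor of
`f_v`: this is the counting identity `MarkedCover.sum_leaves_eq`, which follows from the
combinatorial `sum_branch_sub_eq` and from the constancy of the degree over each vertex. Hence `f_n`
and `f_v` are constants times one and the same expression `leafProd`, evaluated at convergent
markings.

The constants converge too. Subtracting from the map its value at a third leaf gives a second
function of the same kind, with the same poles. Comparing the two expressions at two points where
`f_v` takes different values gives linear equations, solvable in the limit: they determine the
leading constant when the third target value is normalized to `1` (`tendsto_coeff`), and then the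
remaining target markings (`tendsto_shift`). The joint limit in `n` and in the point is exactly
locally uniform convergence away from the attaching points. -/

/-- The point of the Riemann sphere with homogeneous coordinates `(a : b)`. -/
def proj (a b : ℂ) : RSphere := if b = 0 then OnePoint.infty else ((a / b : ℂ) : OnePoint ℂ)

theorem proj_one (a : ℂ) : proj a 1 = (a : OnePoint ℂ) := by simp [proj]

theorem proj_zero_right (a : ℂ) : proj a 0 = OnePoint.infty := by simp [proj]

theorem proj_of_ne {a b : ℂ} (hb : b ≠ 0) : proj a b = ((a / b : ℂ) : OnePoint ℂ) := by
  simp [proj, hb]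

theorem smul_proj (g : Matrix.GeneralLinearGroup (Fin 2) ℂ) {a b : ℂ} (h : a ≠ 0 ∨ b ≠ 0) :
    g • proj a b = proj (g 0 0 * a + g 0 1 * b) (g 1 0 * a + g 1 1 * b) := by
  unfold proj
  by_cases hb : b = 0
  · subst hb
    have ha : a ≠ 0 := by simpa using h
    simp only [if_true, OnePoint.smul_infty_eq_ite, mul_zero, add_zero, mul_eq_zero, ha, or_false]
    split_ifs with h0
    · rfl
    · rw [mul_div_mul_right _ _ ha]
  · have e : g 1 0 * (a / b) + g 1 1 = (g 1 0 * a + g 1 1 * b) / b := by field_simp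
    have e' : g 0 0 * (a / b) + g 0 1 = (g 0 0 * a + g 0 1 * b) / b := by field_simp
    simp only [hb, if_false, OnePoint.smul_some_eq_ite, e, e', div_eq_zero_iff, or_false]
    split_ifs with h0
    · rfl
    · rw [div_div_div_cancel_right₀ hb]

theorem tendsto_coe_infty {ι : Type*} {l : Filter ι} {s : ι → ℂ}
    (h : Tendsto (fun i => ‖s i‖) l atTop) :
    Tendsto (fun i => ((s i : ℂ) : OnePoint ℂ)) l (𝓝 OnePoint.infty) := by
  have h1 : Tendsto ((↑) : ℂ → OnePoint ℂ) (cocompact ℂ) (𝓝 OnePoint.infty) := by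
    rw [← coclosedCompact_eq_cocompact]
    exact OnePoint.tendsto_coe_infty
  exact h1.comp (tendsto_norm_atTop_iff_cobounded.1 h |>.mono_right
    (by rw [Metric.cobounded_eq_cocompact]))

/-- The only delicate limit is `∞`: on the indices with zero denominator the value is already `∞`,
and on the others `t / s` tends to `0` through nonzero values, so that `s / t` escapes to infinity.
-/
theorem tendsto_proj {ι : Type*} {l : Filter ι} {s t : ι → ℂ} {a b : ℂ} (hs : Tendsto s l (𝓝 a))
    (ht : Tendsto t l (𝓝 b)) (h : a ≠ 0 ∨ b ≠ 0) :
    Tendsto (fun i => proj (s i) (t i)) l (𝓝 (proj a b)) := by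
  by_cases hb : b = 0
  · subst hb
    have ha : a ≠ 0 := by simpa using h
    rw [proj_zero_right]
    have key : Tendsto (fun i => proj (s i) (t i)) (l ⊓ 𝓟 {i | t i ≠ 0}) (𝓝 OnePoint.infty) := by
      have h1 : Tendsto (fun i => t i / s i) (l ⊓ 𝓟 {i | t i ≠ 0}) (𝓝[≠] 0) := by
        refine tendsto_nhdsWithin_iff.2 ⟨?_, ?_⟩
        · have := (ht.div hs ha).mono_left (inf_le_left (b := 𝓟 {i | t i ≠ 0}))
          rwa [zero_div] at this
        · have := (hs.eventually_ne ha).filter_mono (inf_le_left (b := 𝓟 {i | t i ≠ 0}))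
          filter_upwards [this, mem_inf_of_right (mem_principal_self _)] with i h1 h2
          exact div_ne_zero h2 h1
      have h2 := tendsto_coe_infty (tendsto_norm_inv_nhdsNE_zero_atTop.comp h1)
      refine h2.congr' ?_
      filter_upwards [mem_inf_of_right (mem_principal_self _)] with i hi
      rw [proj_of_ne hi, inv_div]
    intro U hU
    have := key hU
    rw [mem_map, mem_inf_principal] at this
    rw [mem_map]
    filter_upwards [this] with i hi
    by_cases h0 : t i = 0
    · rw [mem_preimage, h0, proj_zero_right]
      exact mem_of_mem_nhds hU
    · exact hi h0
  · rw [proj_of_ne hb]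
    refine ((OnePoint.continuous_coe.tendsto _).comp (hs.div ht hb)).congr' ?_
    filter_upwards [ht.eventually_ne hb] with i hi
    rw [proj_of_ne hi]
    rfl

/-- The first homogeneous coordinate of `param x t`. -/
def paramNum : RSphere → ℂ → ℂ
  | OnePoint.some x, t => x + t
  | OnePoint.infty, _ => 1

/-- The second homogeneous coordinate of `param x t`. -/
def paramDen : RSphere → ℂ → ℂ
  | OnePoint.some _, _ => 1
  | OnePoint.infty, t => t

theorem param_eq_proj (x : RSphere) (t : ℂ) : param x t = proj (paramNum x t) (paramDen x t) := by
  induction x using OnePoint.rec with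
  | infty =>
    by_cases h : t = 0 <;> simp [param, paramNum, paramDen, proj, h]
  | coe x => simp [param, paramNum, paramDen, proj]

theorem param_ne (x : RSphere) (t : ℂ) : paramNum x t ≠ 0 ∨ paramDen x t ≠ 0 := by
  induction x using OnePoint.rec <;> simp [paramNum, paramDen]

theorem continuous_paramNum (x : RSphere) : Continuous (paramNum x) := by
  induction x using OnePoint.rec with
  | infty => exact continuous_const
  | coe x => exact continuous_const.add continuous_id

theorem continuous_paramDen (x : RSphere) : Continuous (paramDen x) := by
  induction x using OnePoint.rec with
  | infty => exact continuous_id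
  | coe x => exact continuous_const

theorem continuous_param (x : RSphere) : Continuous (param x) := by
  refine continuous_iff_continuousAt.2 fun t => ?_
  have e : param x = fun t => proj (paramNum x t) (paramDen x t) := funext (param_eq_proj x)
  rw [e]
  exact tendsto_proj ((continuous_paramNum x).tendsto t) ((continuous_paramDen x).tendsto t)
    (param_ne x t)

@[simp] theorem param_zero (x : RSphere) : param x 0 = x := by
  induction x using OnePoint.rec <;> simp [param]

@[simp] theorem coord_self (x : RSphere) : coord x x = 0 := by
  induction x using OnePoint.rec with
  | infty => rfl
  | coe x => exact sub_self x

theorem coord_proj_coe (p : ℂ) {a b : ℂ} (hb : b ≠ 0) : coord (p : OnePoint ℂ) (proj a b) = a / b - p := by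
  rw [proj_of_ne hb]; rfl

theorem coord_proj_infty {a b : ℂ} : coord OnePoint.infty (proj a b) = b / a := by
  unfold proj
  split_ifs with h
  · simp [coord, h]
  · simp [coord]

theorem eventually_param_coord (p : RSphere) : ∀ᶠ q in 𝓝 p, param p (coord p q) = q := by
  induction p using OnePoint.rec with
  | infty =>
    have : ((0 : ℂ) : OnePoint ℂ) ≠ OnePoint.infty := OnePoint.coe_ne_infty 0
    filter_upwards [isOpen_ne.mem_nhds this.symm] with q hq
    induction q using OnePoint.rec with
    | infty => simp [param, coord]
    | coe q =>
      have : q ≠ 0 := by rintro rfl; exact hq rfl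
      simp [param, coord, this]
  | coe p =>
    filter_upwards [isOpen_ne.mem_nhds (OnePoint.coe_ne_infty p)] with q hq
    induction q using OnePoint.rec with
    | infty => exact absurd rfl hq
    | coe q => simp [param, coord]

theorem tendsto_coord (p : RSphere) : Tendsto (coord p) (𝓝 p) (𝓝 0) := by
  induction p using OnePoint.rec with
  | infty =>
    rw [OnePoint.tendsto_nhds_infty]
    intro s hs
    refine ⟨mem_of_mem_nhds hs, ?_⟩
    obtain ⟨ε, hε, hs⟩ := Metric.mem_nhds_iff.1 hs
    refine ⟨Metric.closedBall 0 ε⁻¹, Metric.isClosed_closedBall, isCompact_closedBall _ _, ?_⟩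
    intro z hz
    apply hs
    simp only [mem_compl_iff, Metric.mem_closedBall, dist_zero_right, not_le] at hz
    simp only [Function.comp_apply, coord, mem_ball_zero_iff, norm_inv]
    exact inv_lt_of_inv_lt₀ hε hz
  | coe p =>
    rw [OnePoint.nhds_coe_eq, tendsto_map'_iff]
    have : Tendsto (fun q : ℂ => q - p) (𝓝 p) (𝓝 (p - p)) :=
      (continuous_id.sub continuous_const).tendsto p
    simpa [Function.comp_def, coord] using this

/-! ### Moebius maps as homeomorphisms, and invariance of the local degree. -/

theorem det_ne (g : Matrix.GeneralLinearGroup (Fin 2) ℂ) : g 0 0 * g 1 1 - g 0 1 * g 1 0 ≠ 0 := by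
  have := g.det_ne_zero
  rwa [Matrix.det_fin_two] at this

theorem smul_ne (g : Matrix.GeneralLinearGroup (Fin 2) ℂ) {a b : ℂ} (h : a ≠ 0 ∨ b ≠ 0) :
    g 0 0 * a + g 0 1 * b ≠ 0 ∨ g 1 0 * a + g 1 1 * b ≠ 0 := by
  by_contra! hc
  have h1 : (g 0 0 * g 1 1 - g 0 1 * g 1 0) * a = 0 := by linear_combination g 1 1 * hc.1 - g 0 1 * hc.2
  have h2 : (g 0 0 * g 1 1 - g 0 1 * g 1 0) * b = 0 := by linear_combination g 0 0 * hc.2 - g 1 0 * hc.1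
  simp only [mul_eq_zero, det_ne g, false_or] at h1 h2
  simp [h1, h2] at h

theorem continuous_moebius (g : Matrix.GeneralLinearGroup (Fin 2) ℂ) :
    Continuous fun x : RSphere => g • x := by
  refine continuous_iff_continuousAt.2 fun p => ?_
  have h1 : Tendsto (fun t => g • param p t) (𝓝 0) (𝓝 (g • param p 0)) := by
    simp only [param_eq_proj, smul_proj g (param_ne p _)]
    refine tendsto_proj ?_ ?_ (smul_ne g (param_ne p _))
    · exact (((continuous_paramNum p).const_mul _).add ((continuous_paramDen p).const_mul _)).tendsto 0
    · exact (((continuous_paramNum p).const_mul _).add ((continuous_paramDen p).const_mul _)).tendsto 0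
  have h2 := h1.comp (tendsto_coord p)
  rw [param_zero] at h2
  refine h2.congr' ?_
  filter_upwards [eventually_param_coord p] with q hq
  simp [hq]

/-- A Moebius transformation as a homeomorphism of the Riemann sphere. -/
def moebius (g : Matrix.GeneralLinearGroup (Fin 2) ℂ) : RSphere ≃ₜ RSphere where
  toEquiv := MulAction.toPerm g
  continuous_toFun := continuous_moebius g
  continuous_invFun := continuous_moebius g⁻¹

@[simp] theorem moebius_apply (g : Matrix.GeneralLinearGroup (Fin 2) ℂ) (x : RSphere) :
    moebius g x = g • x := rfl

/-- Simple zeros in local coordinates are what makes orders of vanishing insensitive to composition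
with a Moebius map on either side. Here the derivative at `0` is, up to sign, the determinant
divided by a square, or a quotient of two nonzero coefficients when the image is `∞`. -/
theorem localRep_moebius (g : Matrix.GeneralLinearGroup (Fin 2) ℂ) (x : RSphere) :
    AnalyticAt ℂ (localRep (moebius g) x) 0 ∧ deriv (localRep (moebius g) x) 0 ≠ 0 := by
  -- the coordinates of the image are affine functions of the parameter
  obtain ⟨A, B, C, D, hdet, hrep⟩ : ∃ A B C D : ℂ, A * D - B * C ≠ 0 ∧
      ∀ t, g • param x t = proj (A + B * t) (C + D * t) := by
    induction x using OnePoint.rec with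
    | infty =>
      refine ⟨g 0 0, g 0 1, g 1 0, g 1 1, det_ne g, fun t => ?_⟩
      rw [param_eq_proj, smul_proj g (param_ne _ _)]
      simp [paramNum, paramDen]
    | coe x =>
      refine ⟨g 0 0 * x + g 0 1, g 0 0, g 1 0 * x + g 1 1, g 1 0, ?_, fun t => ?_⟩
      · have := det_ne g
        contrapose! this
        linear_combination -this
      · rw [param_eq_proj, smul_proj g (param_ne _ _)]
        simp only [paramNum, paramDen]
        congr 1 <;> ring
  have hx : g • x = proj A C := by simpa using hrep 0
  by_cases hC : C = 0
  · subst hC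
    have hA : A ≠ 0 := by rintro rfl; simp at hdet
    have hD : D ≠ 0 := by rintro rfl; simp at hdet
    have e : localRep (moebius g) x = fun t => (D * t) / (A + B * t) := by
      funext t
      simp only [localRep, moebius_apply, hrep, hx, proj_zero_right, coord_proj_infty, zero_add]
    have hd : HasDerivAt (fun t : ℂ => (D * t) / (A + B * t)) (D / A) 0 := by
      have h1 : HasDerivAt (fun t : ℂ => D * t) D 0 := by simpa using (hasDerivAt_id (0 : ℂ)).const_mul D
      have h2 : HasDerivAt (fun t : ℂ => A + B * t) B 0 := by
        simpa using ((hasDerivAt_id (0 : ℂ)).const_mul B).const_add A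
      refine (h1.div h2 (by simpa using hA)).congr_deriv ?_
      simp only [mul_zero, add_zero, zero_mul, sub_zero]
      field_simp
    rw [e]
    refine ⟨?_, by rw [hd.deriv]; exact div_ne_zero hD hA⟩
    apply AnalyticAt.div <;> [fun_prop; fun_prop; simpa using hA]
  · have e : localRep (moebius g) x =ᶠ[𝓝 0] fun t => (A + B * t) / (C + D * t) - A / C := by
      have : ∀ᶠ t : ℂ in 𝓝 0, C + D * t ≠ 0 := by
        have : Continuous fun t : ℂ => C + D * t := by fun_prop
        exact this.continuousAt.eventually_ne (by simpa using hC)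
      filter_upwards [this] with t ht
      simp only [localRep, moebius_apply, hrep, hx, proj_of_ne hC]
      rw [coord_proj_coe _ ht]
    have hd : HasDerivAt (fun t : ℂ => (A + B * t) / (C + D * t) - A / C)
        ((B * C - A * D) / C ^ 2) 0 := by
      have h1 : HasDerivAt (fun t : ℂ => A + B * t) B 0 := by
        simpa using ((hasDerivAt_id (0 : ℂ)).const_mul B).const_add A
      have h2 : HasDerivAt (fun t : ℂ => C + D * t) D 0 := by
        simpa using ((hasDerivAt_id (0 : ℂ)).const_mul D).const_add C
      refine ((h1.div h2 (by simpa using hC)).sub_const (A / C)).congr_deriv ?_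
      simp only [mul_zero, add_zero]
    rw [e.deriv_eq, analyticAt_congr e, hd.deriv]
    refine ⟨?_, div_ne_zero ?_ (pow_ne_zero _ hC)⟩
    · apply AnalyticAt.sub _ analyticAt_const
      apply AnalyticAt.div <;> [fun_prop; fun_prop; simpa using hC]
    · contrapose! hdet
      linear_combination -hdet

theorem localRep_zero (f : RSphere → RSphere) (x : RSphere) : localRep f x 0 = 0 := by
  simp [localRep]

theorem localRep_comp {f : RSphere → RSphere} (g : RSphere → RSphere) (hf : Continuous f)
    (x : RSphere) : localRep (g ∘ f) x =ᶠ[𝓝 0] localRep g (f x) ∘ localRep f x := by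
  have h : Tendsto (fun t => f (param x t)) (𝓝 0) (𝓝 (f x)) := by
    have := (hf.comp (continuous_param x)).tendsto 0
    rwa [Function.comp_apply, param_zero] at this
  filter_upwards [h.eventually (eventually_param_coord (f x))] with t ht
  simp [localRep, ht]

theorem localDeg_moebius_comp {f : RSphere → RSphere} (hf : Continuous f) {x : RSphere}
    (hfx : AnalyticAt ℂ (localRep f x) 0) (g : Matrix.GeneralLinearGroup (Fin 2) ℂ) :
    localDeg (moebius g ∘ f) x = localDeg f x := by
  unfold localDeg analyticOrderNatAt
  rw [analyticOrderAt_congr (localRep_comp _ hf x)]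
  obtain ⟨h1, h2⟩ := localRep_moebius g (f x)
  have h3 : localRep f x 0 = 0 := localRep_zero f x
  have h4 : analyticOrderAt (localRep (moebius g) (f x)) 0 = 1 :=
    h1.analyticOrderAt_eq_one_of_zero_deriv_ne_zero (localRep_zero _ _) h2
  rw [← h3] at h1
  rw [h1.analyticOrderAt_comp hfx, h3]
  simp [h4]

theorem localDeg_comp_moebius (f : RSphere → RSphere) (g : Matrix.GeneralLinearGroup (Fin 2) ℂ)
    (x : RSphere) : localDeg (f ∘ moebius g) x = localDeg f (g • x) := by
  unfold localDeg analyticOrderNatAt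
  rw [analyticOrderAt_congr (localRep_comp _ (moebius g).continuous x)]
  obtain ⟨h1, h2⟩ := localRep_moebius g x
  rw [analyticOrderAt_comp_of_deriv_ne_zero h1 h2, localRep_zero]
  rfl

/-! ### Charts of a projective sphere -/

theorem ProjSphere.exists_smul_chart (S : ProjSphere.{w}) {σ τ : S ≃ₜ RSphere} (hσ : σ ∈ S.charts)
    (hτ : τ ∈ S.charts) : ∃ g : Matrix.GeneralLinearGroup (Fin 2) ℂ, ∀ x, τ x = g • σ x :=
  (S.mem_charts_iff σ hσ τ).1 hτ

theorem ProjSphere.trans_moebius_mem (S : ProjSphere.{w}) {σ : S ≃ₜ RSphere} (hσ : σ ∈ S.charts)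
    (g : Matrix.GeneralLinearGroup (Fin 2) ℂ) : σ.trans (moebius g) ∈ S.charts :=
  (S.mem_charts_iff σ hσ _).2 ⟨g, fun _ => rfl⟩

theorem ProjSphere.chart_mem (S : ProjSphere.{w}) : S.chart ∈ S.charts := S.charts_nonempty.some_mem

/-- `localDegree` is defined with one arbitrary chart on each side. Another choice changes the
coordinate expression by Moebius maps before and after, which preserve the order of vanishing. -/
theorem localDegree_eq {S S' : ProjSphere.{w}} {f : S → S'} (hf : IsHolomorphic f)
    {σ : S ≃ₜ RSphere} (hσ : σ ∈ S.charts) {τ : S' ≃ₜ RSphere} (hτ : τ ∈ S'.charts) (x : S) :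
    localDegree f x = localDeg (fun y => τ (f (σ.symm y))) (σ x) := by
  obtain ⟨g, hg⟩ := S.exists_smul_chart hσ S.chart_mem
  obtain ⟨h, hh⟩ := S'.exists_smul_chart hτ S'.chart_mem
  have hF := hf σ hσ τ hτ
  have e : (fun y => S'.chart (f (S.chart.symm y))) =
      moebius h ∘ ((fun y => τ (f (σ.symm y))) ∘ moebius g⁻¹) := by
    funext y
    have : S.chart.symm y = σ.symm (g⁻¹ • y) := by
      rw [Homeomorph.symm_apply_eq, hg]
      simp
    simp [hh, this]
  have hF' := hf S.chart S.chart_mem τ hτ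
  have e' : (fun y => τ (f (S.chart.symm y))) = (fun y => τ (f (σ.symm y))) ∘ moebius g⁻¹ := by
    funext y
    have : S.chart.symm y = σ.symm (g⁻¹ • y) := by
      rw [Homeomorph.symm_apply_eq, hg]
      simp
    simp [this]
  rw [e'] at hF'
  unfold localDegree
  rw [e, localDeg_moebius_comp hF'.1 (hF'.2 _), localDeg_comp_moebius, hg, inv_smul_smul]

end

section

/-! ### Holomorphic self-maps of the Riemann sphere are rational -/

theorem tendsto_inv_cocompact : Tendsto (fun x : ℂ => x⁻¹) (cocompact ℂ) (𝓝 0) := by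
  rw [← Metric.cobounded_eq_cocompact]
  exact tendsto_inv₀_cobounded'.mono_right nhdsWithin_le_nhds

theorem zpow_sum₀ {ι : Type*} {x : ℂ} (hx : x ≠ 0) (s : Finset ι) (f : ι → ℤ) :
    x ^ (∑ i ∈ s, f i) = ∏ i ∈ s, x ^ f i := by
  classical
  induction s using Finset.induction_on with
  | empty => simp
  | insert a s ha ih => rw [Finset.sum_insert ha, Finset.prod_insert ha, zpow_add₀ hx, ih]

theorem tendsto_prod_zpow_div (A : Finset ℂ) (D : ℂ → ℤ) :
    Tendsto (fun x : ℂ => ∏ a ∈ A, ((x - a) / x) ^ D a) (cocompact ℂ) (𝓝 1) := by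
  have h1 : ∀ a ∈ A, Tendsto (fun x : ℂ => ((x - a) / x) ^ D a) (cocompact ℂ) (𝓝 1) := by
    intro a _
    have h2 : Tendsto (fun x : ℂ => (x - a) / x) (cocompact ℂ) (𝓝 1) := by
      have : Tendsto (fun x : ℂ => 1 - a * x⁻¹) (cocompact ℂ) (𝓝 (1 - a * 0)) :=
        tendsto_const_nhds.sub (tendsto_inv_cocompact.const_mul a)
      rw [mul_zero, sub_zero] at this
      refine this.congr' ?_
      filter_upwards [isCompact_singleton (x := (0 : ℂ)).compl_mem_cocompact] with x hx
      have : x ≠ 0 := by simpa using hx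
      field_simp
    have := h2.zpow₀ (D a) (Or.inl one_ne_zero)
    rwa [one_zpow] at this
  simpa using tendsto_finsetProd A h1

/-- Dividing `r` by the product with the prescribed divisor leaves a function with only removable
singularities and no zeros. Its behaviour at infinity is that of a power of `x`, so Liouville's
theorem excludes a nonzero exponent and then makes the function constant. -/
theorem eq_mul_prod_of_meromorphic {r : ℂ → ℂ} {A : Finset ℂ} {D : ℂ → ℤ} {L : ℂ}
    (hmer : ∀ a ∈ A, MeromorphicAt r a) (hord : ∀ a ∈ A, meromorphicOrderAt r a = D a)
    (han : ∀ x ∉ A, AnalyticAt ℂ r x ∧ r x ≠ 0) (hL : L ≠ 0) (hr : Tendsto r (cocompact ℂ) (𝓝 L)) :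
    ∑ a ∈ A, D a = 0 ∧ ∀ x ∉ A, r x = L * ∏ a ∈ A, (x - a) ^ D a := by
  have hrm : ∀ x, MeromorphicAt r x := fun x => by
    by_cases hx : x ∈ A
    · exact hmer x hx
    · exact (han x hx).1.meromorphicAt
  have hro : ∀ x, meromorphicOrderAt r x = if x ∈ A then (D x : WithTop ℤ) else 0 := fun x => by
    split_ifs with hx
    · exact hord x hx
    · rw [(han x hx).1.meromorphicOrderAt_eq, (han x hx).1.analyticOrderAt_eq_zero.2 (han x hx).2]
      rfl
  let p : ℂ → ℂ := fun x => ∏ a ∈ A, (x - a) ^ (-D a)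
  have hfac : ∀ a x : ℂ, MeromorphicAt (fun x : ℂ => (x - a) ^ (-D a)) x := fun a x => by
    have : MeromorphicAt (fun x : ℂ => x - a) x := by
      apply AnalyticAt.meromorphicAt; fun_prop
    exact this.zpow _
  have hpm : ∀ x, MeromorphicAt p x := fun x =>
    MeromorphicAt.fun_prod fun a _ => hfac a x
  have hfo : ∀ a x : ℂ, meromorphicOrderAt (fun x : ℂ => (x - a) ^ (-D a)) x =
      if a = x then ((-D a : ℤ) : WithTop ℤ) else 0 := fun a x => by
    have ha : AnalyticAt ℂ (fun x : ℂ => x - a) x := by fun_prop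
    have h1 : meromorphicOrderAt (fun x : ℂ => (x - a) ^ (-D a)) x =
        (-D a) * meromorphicOrderAt (fun x : ℂ => x - a) x :=
      meromorphicOrderAt_zpow ha.meromorphicAt
    rw [h1, ha.meromorphicOrderAt_eq]
    split_ifs with h
    · subst h
      have := analyticOrderAt_id_sub_const_self (𝕜 := ℂ) (c := a)
      have h2 : analyticOrderAt (fun x : ℂ => x - a) a = 1 := by
        rw [← this]
      rw [h2]
      simp
    · have h2 : analyticOrderAt (fun x : ℂ => x - a) x = 0 :=
        ha.analyticOrderAt_eq_zero.2 (sub_ne_zero.2 (Ne.symm h))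
      rw [h2]
      simp
  have hpo : ∀ x, meromorphicOrderAt p x = if x ∈ A then ((-D x : ℤ) : WithTop ℤ) else 0 := fun x => by
    have h1 : meromorphicOrderAt p x =
        ∑ a ∈ A, meromorphicOrderAt (fun x : ℂ => (x - a) ^ (-D a)) x :=
      meromorphicOrderAt_fun_prod fun a _ => hfac a x
    rw [h1]
    simp only [hfo]
    rw [Finset.sum_ite_eq']
  have hgm : MeromorphicOn (r * p) univ := fun x _ => (hrm x).mul (hpm x)
  have hgo : ∀ x, meromorphicOrderAt (r * p) x = 0 := fun x => by
    rw [meromorphicOrderAt_mul (hrm x) (hpm x), hro, hpo]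
    split_ifs
    · rw [← WithTop.coe_add]; simp
    · simp
  -- Since `r * p` has order `0` everywhere, its normal form removes the singularities on `A`: it is
  -- entire and vanishes nowhere.
  let h := toMeromorphicNFOn (r * p) univ
  have hnf : MeromorphicNFOn h univ := meromorphicNFOn_toMeromorphicNFOn _ _
  have hho : ∀ x, meromorphicOrderAt h x = 0 := fun x => by
    rw [meromorphicOrderAt_toMeromorphicNFOn hgm (mem_univ x), hgo]
  have hha : ∀ x, AnalyticAt ℂ h x := fun x =>
    (hnf (mem_univ x)).meromorphicOrderAt_nonneg_iff_analyticAt.1 (hho x).ge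
  have hh0 : ∀ x, h x ≠ 0 := fun x =>
    (hnf (mem_univ x)).meromorphicOrderAt_eq_zero_iff.1 (hho x)
  have hpa : ∀ x ∉ A, AnalyticAt ℂ p x := fun x hx => by
    refine Finset.analyticAt_fun_prod _ fun a ha => ?_
    refine AnalyticAt.zpow (by fun_prop) (sub_ne_zero.2 ?_)
    rintro rfl; exact hx ha
  have hheq : ∀ x ∉ A, h x = r x * p x := fun x hx => by
    have h1 : h =ᶠ[𝓝[≠] x] r * p := (hgm.toMeromorphicNFOn_eq_self_on_nhdsNE (mem_univ x))
    have h2 : AnalyticAt ℂ (r * p) x := (han x hx).1.mul (hpa x hx)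
    have := ((hha x).frequently_eq_iff_eventually_eq h2).1 h1.frequently
    exact this.self_of_nhds
  have hinv : ∀ x ∉ A, p x * ∏ a ∈ A, (x - a) ^ D a = 1 := fun x hx => by
    rw [← Finset.prod_mul_distrib]
    refine Finset.prod_eq_one fun a ha => ?_
    rw [← zpow_add₀ (sub_ne_zero.2 (by rintro rfl; exact hx ha))]
    simp
  have hev : ∀ᶠ x in cocompact ℂ, x ∉ A ∧ x ≠ 0 := by
    filter_upwards [A.finite_toSet.isCompact.compl_mem_cocompact,
      isCompact_singleton (x := (0 : ℂ)).compl_mem_cocompact] with x h1 h2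
    exact ⟨by simpa using h1, by simpa using h2⟩
  set k := ∑ a ∈ A, D a with hk
  have hhk : ∀ᶠ x in cocompact ℂ, h x = r x * (∏ a ∈ A, ((x - a) / x) ^ (-D a)) * x ^ (-k) := by
    filter_upwards [hev] with x hx
    rw [hheq x hx.1, mul_assoc]
    congr 1
    have : x ^ (-k) = ∏ a ∈ A, x ^ (-D a) := by
      rw [hk, ← Finset.sum_neg_distrib]
      exact zpow_sum₀ hx.2 _ _
    rw [this, ← Finset.prod_mul_distrib]
    refine Finset.prod_congr rfl fun a _ => ?_
    rw [← mul_zpow, div_mul_cancel₀ _ hx.2]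
  have hmain : Tendsto (fun x => r x * (∏ a ∈ A, ((x - a) / x) ^ (-D a))) (cocompact ℂ) (𝓝 L) := by
    simpa using hr.mul (tendsto_prod_zpow_div A fun a => -D a)
  have hpow : ∀ n : ℤ, n < 0 → Tendsto (fun x : ℂ => x ^ n) (cocompact ℂ) (𝓝 0) := fun n hn => by
    obtain ⟨m, hm, rfl⟩ : ∃ m : ℕ, m ≠ 0 ∧ n = -m := ⟨n.natAbs, by omega, by omega⟩
    have := tendsto_inv_cocompact.pow m
    simpa [hm] using this
  have hdiff : Differentiable ℂ h := fun x => (hha x).differentiableAt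
  -- At infinity `h` behaves like `L * x ^ (-k)`. If `k < 0` then `h⁻¹` is entire and tends to `0`;
  -- if `k > 0` then `h` itself does. Either would have to vanish identically.
  rcases lt_trichotomy k 0 with hneg | hzero | hpos
  · have h1 : Tendsto h⁻¹ (cocompact ℂ) (𝓝 (L⁻¹ * 0)) := by
      refine ((hmain.inv₀ hL).mul (hpow k hneg)).congr' ?_
      filter_upwards [hhk] with x hx
      rw [Pi.inv_apply, hx, mul_inv (_ * _), zpow_neg, inv_inv]
    have := (hdiff.inv hh0).apply_eq_of_tendsto_cocompact 0 h1
    rw [mul_zero] at this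
    exact absurd this (inv_ne_zero (hh0 0))
  · refine ⟨hzero, fun x hx => ?_⟩
    have h1 : Tendsto h (cocompact ℂ) (𝓝 L) := by
      refine hmain.congr' ?_
      filter_upwards [hhk] with x hx
      rw [hx, hzero, neg_zero, zpow_zero, mul_one]
    have := hdiff.apply_eq_of_tendsto_cocompact x h1
    rw [← this, hheq x hx, mul_assoc, hinv x hx, mul_one]
  · have h1 : Tendsto h (cocompact ℂ) (𝓝 (L * 0)) := by
      refine (hmain.mul (hpow (-k) (by omega))).congr' ?_
      filter_upwards [hhk] with x hx
      rw [hx]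
    have := hdiff.apply_eq_of_tendsto_cocompact 0 h1
    rw [mul_zero] at this
    exact absurd this (hh0 0)

/-- The affine coordinate on the Riemann sphere, with value `0` at `∞`. -/
def toC (x : RSphere) : ℂ := coord ((0 : ℂ) : OnePoint ℂ) x

@[simp] theorem toC_coe (x : ℂ) : toC (x : OnePoint ℂ) = x := sub_zero x

@[simp] theorem toC_infty : toC OnePoint.infty = 0 := rfl

theorem coe_toC {x : RSphere} (h : x ≠ OnePoint.infty) : ((toC x : ℂ) : OnePoint ℂ) = x := by
  induction x using OnePoint.rec with
  | infty => exact absurd rfl h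
  | coe x => simp

theorem continuousAt_toC {x : RSphere} (h : x ≠ OnePoint.infty) : ContinuousAt toC x := by
  induction x using OnePoint.rec with
  | infty => exact absurd rfl h
  | coe x =>
    rw [OnePoint.continuousAt_coe]
    have : toC ∘ ((↑) : ℂ → OnePoint ℂ) = id := by funext x; simp
    rw [this]
    exact continuousAt_id

theorem coord_infty_eq (x : RSphere) : coord OnePoint.infty x = (toC x)⁻¹ := by
  induction x using OnePoint.rec with
  | infty => simp [coord]
  | coe x => simp [coord]

theorem toC_eq_zero_iff {x : RSphere} :
    toC x = 0 ↔ x = ((0 : ℂ) : OnePoint ℂ) ∨ x = OnePoint.infty := by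
  induction x using OnePoint.rec with
  | infty => simp
  | coe x => simp

theorem param_coe (x t : ℂ) : param (x : OnePoint ℂ) t = ((x + t : ℂ) : OnePoint ℂ) := rfl

theorem IsHolo.analyticAt_toC {F : RSphere → RSphere} (hF : IsHolo F) {x : ℂ}
    (hx : F (x : OnePoint ℂ) ≠ OnePoint.infty) :
    AnalyticAt ℂ (fun z : ℂ => toC (F z)) x ∧
      (F (x : OnePoint ℂ) = ((0 : ℂ) : OnePoint ℂ) →
        analyticOrderAt (fun z : ℂ => toC (F z)) x = analyticOrderAt (localRep F x) 0) := by
  have hc : Continuous fun z : ℂ => F (z : OnePoint ℂ) := hF.1.comp OnePoint.continuous_coe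
  have hev : (fun z : ℂ => toC (F z)) =ᶠ[𝓝 x] fun z => toC (F x) + localRep F x (z - x) := by
    filter_upwards [(isOpen_ne.preimage hc).mem_nhds hx] with z hz
    rw [localRep, param_coe, add_sub_cancel, ← coe_toC hx, ← coe_toC (x := F z) hz]
    simp [coord]
  have hsub : AnalyticAt ℂ (fun z : ℂ => z - x) x := by fun_prop
  have hd : deriv (fun z : ℂ => z - x) x ≠ 0 := by simp
  have hrep : AnalyticAt ℂ (localRep F x) ((fun z : ℂ => z - x) x) := by
    simpa using hF.2 x
  refine ⟨?_, fun h0 => ?_⟩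
  · rw [analyticAt_congr hev]
    exact analyticAt_const.add (AnalyticAt.comp (g := localRep F x) (f := fun z : ℂ => z - x) hrep hsub)
  · rw [analyticOrderAt_congr hev, h0]
    have : (fun z => toC ((0 : ℂ) : OnePoint ℂ) + localRep F x (z - x)) =
        localRep F x ∘ fun z : ℂ => z - x := by
      funext z; simp
    rw [this, analyticOrderAt_comp_of_deriv_ne_zero hsub hd, sub_self]

theorem IsHolo.analyticAt_inv_toC {F : RSphere → RSphere} (hF : IsHolo F) {x : ℂ}
    (hx : F (x : OnePoint ℂ) = OnePoint.infty) :
    AnalyticAt ℂ (fun z : ℂ => (toC (F z))⁻¹) x ∧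
      analyticOrderAt (fun z : ℂ => (toC (F z))⁻¹) x = analyticOrderAt (localRep F x) 0 := by
  have hev : (fun z : ℂ => (toC (F z))⁻¹) = localRep F x ∘ fun z => z - x := by
    funext z
    rw [Function.comp_apply, localRep, param_coe, add_sub_cancel, hx, coord_infty_eq]
  have hsub : AnalyticAt ℂ (fun z : ℂ => z - x) x := by fun_prop
  have hd : deriv (fun z : ℂ => z - x) x ≠ 0 := by simp
  have hrep : AnalyticAt ℂ (localRep F x) ((fun z : ℂ => z - x) x) := by
    simpa using hF.2 x
  rw [hev]
  refine ⟨AnalyticAt.comp (g := localRep F x) (f := fun z : ℂ => z - x) hrep hsub, ?_⟩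
  rw [analyticOrderAt_comp_of_deriv_ne_zero hsub hd, sub_self]

/-- A holomorphic self-map of the Riemann sphere whose zeros and poles form the finite set `A` is
the rational function with the prescribed divisor. -/
theorem IsHolo.eq_prod {F : RSphere → RSphere} (hF : IsHolo F) {A : Finset ℂ} {D : ℂ → ℤ}
    (hA : ∀ x : ℂ, x ∈ A ↔ F x = ((0 : ℂ) : OnePoint ℂ) ∨ F x = OnePoint.infty)
    (h0 : F OnePoint.infty ≠ ((0 : ℂ) : OnePoint ℂ)) (hi : F OnePoint.infty ≠ OnePoint.infty)
    (hD0 : ∀ x : ℂ, F x = ((0 : ℂ) : OnePoint ℂ) → D x = localDeg F x)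
    (hDi : ∀ x : ℂ, F x = OnePoint.infty → D x = -localDeg F x) :
    ∑ a ∈ A, D a = 0 ∧ ∃ c : ℂ, c ≠ 0 ∧
      ∀ x : ℂ, x ∉ A → F x = ((c * ∏ a ∈ A, (x - a) ^ D a : ℂ) : OnePoint ℂ) := by
  -- Because `toC` sends `∞` to `0`, the set `A` is exactly the zero set of `toC ∘ F` on `ℂ`. Its
  -- finiteness excludes infinite order, which `localDeg` would record as `0`.
  have hne : ∀ x : ℂ, ∃ᶠ z : ℂ in 𝓝 x, toC (F z) ≠ 0 := by
    intro x
    have h1 : ∀ᶠ z in 𝓝[≠] x, z ∉ A := by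
      have : ((A : Set ℂ) \ {x})ᶜ ∈ 𝓝 x :=
        (A.finite_toSet.subset sdiff_subset).isClosed.compl_mem_nhds (by simp)
      filter_upwards [mem_nhdsWithin_of_mem_nhds this, self_mem_nhdsWithin] with z hz hzx hzA
      exact hz ⟨hzA, hzx⟩
    refine (h1.frequently.filter_mono nhdsWithin_le_nhds).mono fun z hz => ?_
    rw [Ne, toC_eq_zero_iff, ← hA]
    exact hz
  have key := eq_mul_prod_of_meromorphic (r := fun z : ℂ => toC (F z)) (A := A) (D := D)
    (L := toC (F OnePoint.infty)) ?_ ?_ ?_ ?_ ?_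
  · refine ⟨key.1, toC (F OnePoint.infty), ?_, fun x hx => ?_⟩
    · rw [Ne, toC_eq_zero_iff]; tauto
    · rw [← key.2 x hx, coe_toC]
      rw [hA] at hx; tauto
  · intro a ha
    rcases (hA a).1 ha with h | h
    · exact (hF.analyticAt_toC (by rw [h]; exact OnePoint.coe_ne_infty 0)).1.meromorphicAt
    · have := (hF.analyticAt_inv_toC h).1.meromorphicAt.fun_inv
      simpa only [inv_inv] using this
  · intro a ha
    have hfr := hne a
    rcases (hA a).1 ha with h | h
    · obtain ⟨h1, h2⟩ := hF.analyticAt_toC (x := a) (by rw [h]; exact OnePoint.coe_ne_infty 0)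
      have h3 : analyticOrderAt (localRep F a) 0 ≠ ⊤ := by
        rw [← h2 h, Ne, analyticOrderAt_eq_top]
        exact not_eventually.2 hfr
      rw [h1.meromorphicOrderAt_eq, h2 h, hD0 a h, ← Nat.cast_analyticOrderNatAt h3]
      rfl
    · obtain ⟨h1, h2⟩ := hF.analyticAt_inv_toC h
      have h3 : analyticOrderAt (localRep F a) 0 ≠ ⊤ := by
        rw [← h2, Ne, analyticOrderAt_eq_top]
        exact not_eventually.2 (hfr.mono fun z hz => inv_ne_zero hz)
      have h4 : (fun z : ℂ => toC (F z)) = (fun z : ℂ => (toC (F z))⁻¹)⁻¹ := by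
        funext z; simp
      rw [h4, meromorphicOrderAt_inv, h1.meromorphicOrderAt_eq, h2, hDi a h,
        ← Nat.cast_analyticOrderNatAt h3]
      rfl
  · intro x hx
    rw [hA] at hx
    refine ⟨(hF.analyticAt_toC (by tauto)).1, ?_⟩
    rwa [Ne, toC_eq_zero_iff]
  · rw [Ne, toC_eq_zero_iff]; tauto
  · have h1 : Tendsto ((↑) : ℂ → OnePoint ℂ) (cocompact ℂ) (𝓝 OnePoint.infty) := by
      rw [← coclosedCompact_eq_cocompact]
      exact OnePoint.tendsto_coe_infty
    exact (continuousAt_toC hi).tendsto.comp ((hF.1.tendsto _).comp h1)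

end

section

/-! ### Branches of trees -/

section Branch

variable {V : Type*} {G : SimpleGraph V}

/-- The vertices that can be reached from `b` without going through `a`. When `b` is a neighbour of
`a` in a tree, this is the branch at `a` in the direction of `b`. -/
def branch (G : SimpleGraph V) (a b : V) : Set V := {p | ∃ W : G.Walk b p, a ∉ W.support}

theorem self_mem_branch {a b : V} (h : a ≠ b) : b ∈ branch G a b :=
  ⟨SimpleGraph.Walk.nil, by simpa using h⟩

theorem notMem_branch (a b : V) : a ∉ branch G a b := fun ⟨W, hW⟩ => hW W.end_mem_support

theorem branch_walk {a b p q : V} (hp : p ∈ branch G a b) (W : G.Walk p q) (hW : a ∉ W.support) :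
    q ∈ branch G a b := by
  obtain ⟨W', hW'⟩ := hp
  exact ⟨W'.append W, by simp [SimpleGraph.Walk.mem_support_append_iff, hW, hW']⟩

theorem branch_adj {a b p q : V} (hp : p ∈ branch G a b) (h : G.Adj p q) (hq : q ≠ a) :
    q ∈ branch G a b := by
  refine branch_walk hp h.toWalk ?_
  have : a ≠ p := by rintro rfl; exact notMem_branch _ _ hp
  simp [this, hq.symm]

theorem exists_path_of_mem_branch {a b p : V} (hab : G.Adj a b) (hp : p ∈ branch G a b) :
    ∃ W : G.Walk a p, W.IsPath ∧ W.snd = b := by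
  classical
  obtain ⟨W, hW⟩ := hp
  exact ⟨SimpleGraph.Walk.cons hab W.bypass, W.bypass_isPath.cons fun h =>
    hW (W.support_bypass_subset_support h), by simp⟩

theorem mem_branch_snd {a p : V} {W : G.Walk a p} (hW : W.IsPath) (h : a ≠ p) :
    p ∈ branch G a W.snd := by
  cases W with
  | nil => exact absurd rfl h
  | cons hadj W =>
    rw [SimpleGraph.Walk.snd_cons]
    exact ⟨W, ((SimpleGraph.Walk.cons_isPath_iff _ _).1 hW).2⟩

/-- Uniqueness of paths: the branches at `a` are disjoint, since membership in a branch fixes the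
first step of the path from `a`. -/
theorem eq_of_mem_branch (hG : G.IsTree) {a b b' p : V} (hb : G.Adj a b) (hb' : G.Adj a b')
    (h : p ∈ branch G a b) (h' : p ∈ branch G a b') : b = b' := by
  obtain ⟨W, hW, rfl⟩ := exists_path_of_mem_branch hb h
  obtain ⟨W', hW', rfl⟩ := exists_path_of_mem_branch hb' h'
  rw [(hG.existsUnique_path a p).unique hW hW']

theorem exists_mem_branch (hG : G.IsTree) {a p : V} (h : a ≠ p) :
    ∃ b, G.Adj a b ∧ p ∈ branch G a b := by
  obtain ⟨W, hW, -⟩ := hG.existsUnique_path a p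
  exact ⟨W.snd, W.adj_snd (SimpleGraph.Walk.not_nil_of_ne h), mem_branch_snd hW h⟩

theorem eq_of_adj_of_mem_branch (hG : G.IsTree) {a b p : V} (hb : G.Adj a b) (hp : G.Adj a p)
    (h : p ∈ branch G a b) : p = b :=
  (eq_of_mem_branch hG hb hp h (self_mem_branch hp.ne)).symm

theorem dist_of_mem_branch (hG : G.IsTree) {a b p : V} (hb : G.Adj a b) (h : p ∈ branch G a b) :
    G.dist a p = G.dist b p + 1 := by
  classical
  obtain ⟨W, hW⟩ := h
  obtain ⟨U, hU, hlen⟩ := hG.1.exists_path_of_dist a p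
  have h1 : (SimpleGraph.Walk.cons hb W.bypass).IsPath :=
    W.bypass_isPath.cons fun h => hW (W.support_bypass_subset_support h)
  have h2 := (hG.existsUnique_path a p).unique hU h1
  have h3 : G.dist b p ≤ W.bypass.length := SimpleGraph.dist_le _
  have h4 : G.dist a p ≤ G.dist a b + G.dist b p := hG.1.dist_triangle
  have h5 : G.dist a b = 1 := SimpleGraph.dist_eq_one_iff_adj.2 hb
  rw [h2, SimpleGraph.Walk.length_cons] at hlen
  omega

/-- A walk from `c` avoiding `b` cannot reach `a`: up to that point it would place the neighbour `a`
of `b` in the branch towards `c`, forcing `c = a`. -/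
theorem branch_subset (hG : G.IsTree) {a b c : V} (hb : G.Adj a b) (hc : G.Adj b c) (hca : c ≠ a) :
    branch G b c ⊆ branch G a b := by
  classical
  rintro p ⟨W, hW⟩
  refine ⟨SimpleGraph.Walk.cons hc W, ?_⟩
  rw [SimpleGraph.Walk.support_cons, List.mem_cons, not_or]
  refine ⟨hb.ne, fun h => hca ?_⟩
  refine (eq_of_adj_of_mem_branch hG hc hb.symm ⟨W.takeUntil a h, fun h' => hW ?_⟩).symm
  exact W.support_takeUntil_subset_support h h'

end Branch

/-! ### Leaves in branches, and the vertex separating three leaves. -/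

namespace TreeOfSpheres

variable {X : Type u} (T : TreeOfSpheres.{u, v, w} X)

theorem toward_eq_iff (v : T.IV) (x : X) {b : X ⊕ T.IV} (h : T.graph.Adj (Sum.inr v) b) :
    (T.toward v x).1 = b ↔ Sum.inl x ∈ branch T.graph (Sum.inr v) b := by
  have h1 : Sum.inl x ∈ branch T.graph (Sum.inr v) (T.toward v x).1 :=
    mem_branch_snd (T.path_isPath v x) Sum.inr_ne_inl
  refine ⟨?_, fun h2 => eq_of_mem_branch T.isTree (T.toward v x).2 h h1 h2⟩
  rintro rfl
  exact h1

theorem mem_branch_toward (v : T.IV) (x : X) :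
    Sum.inl x ∈ branch T.graph (Sum.inr v) (T.toward v x).1 :=
  (T.toward_eq_iff v x (T.toward v x).2).1 rfl

theorem eq_of_adj_leaf {x : X} {p q : X ⊕ T.IV} (hp : T.graph.Adj (Sum.inl x) p)
    (hq : T.graph.Adj (Sum.inl x) q) : p = q := by
  obtain ⟨r, hr⟩ := Set.ncard_eq_one.1 (T.leaf x)
  have h1 : p ∈ T.graph.neighborSet (Sum.inl x) := hp
  have h2 : q ∈ T.graph.neighborSet (Sum.inl x) := hq
  rw [hr] at h1 h2
  exact h1.trans h2.symm

theorem branch_leaf {a : X ⊕ T.IV} {x : X} (h : T.graph.Adj a (Sum.inl x)) {p : X ⊕ T.IV}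
    (hp : p ∈ branch T.graph a (Sum.inl x)) : p = Sum.inl x := by
  obtain ⟨W, hW⟩ := hp
  cases W with
  | nil => rfl
  | cons hadj W =>
    have := T.eq_of_adj_leaf hadj h.symm
    subst this
    simp at hW

/-- Two adjacent leaves would form the whole tree, leaving no room for a third leaf. -/
theorem exists_adj_leaf [Fintype X] (hX : 3 ≤ Fintype.card X) (x : X) :
    ∃ v, T.graph.Adj (Sum.inl x) (Sum.inr v) := by
  obtain ⟨p, hp⟩ := Set.ncard_eq_one.1 (T.leaf x)
  have hadj : T.graph.Adj (Sum.inl x) p := by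
    have : p ∈ T.graph.neighborSet (Sum.inl x) := by rw [hp]; rfl
    exact this
  cases p with
  | inr v => exact ⟨v, hadj⟩
  | inl y =>
    exfalso
    have hall : ∀ z, z = x ∨ z = y := fun z => by
      by_cases hz : z = x
      · exact Or.inl hz
      · obtain ⟨b, hb, hzb⟩ := exists_mem_branch T.isTree
          (a := Sum.inl x) (p := Sum.inl z) (by simpa using Ne.symm hz)
        have := T.eq_of_adj_leaf hb hadj
        subst this
        exact Or.inr (by simpa using T.branch_leaf hadj hzb)
    classical
    have : Fintype.card X ≤ ({x, y} : Finset X).card :=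
      Finset.card_le_card fun z _ => by simpa using hall z
    exact absurd (this.trans Finset.card_le_two) (by omega)

/-- Moving away from `a`, an internal vertex always offers a further edge, and the branch strictly
shrinks along it. -/
theorem exists_leaf_mem_branch [Finite X] {a b : X ⊕ T.IV} (h : T.graph.Adj a b) :
    ∃ x, Sum.inl x ∈ branch T.graph a b := by
  have := T.finite_IV
  induction hn : (branch T.graph a b).ncard using Nat.strong_induction_on generalizing a b with
  | _ n ih =>
    cases b with
    | inl x => exact ⟨x, self_mem_branch h.ne⟩
    | inr u =>
      obtain ⟨q, hq, hqa⟩ := Set.exists_ne_of_one_lt_ncard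
        (lt_of_lt_of_le (by norm_num) (T.stable u)) a
      have hsub := branch_subset T.isTree h hq hqa
      have hss : branch T.graph (Sum.inr u) q ⊂ branch T.graph a (Sum.inr u) :=
        ⟨hsub, fun h' => notMem_branch _ _ (h' (self_mem_branch h.ne))⟩
      obtain ⟨x, hx⟩ := ih _ (hn ▸ Set.ncard_lt_ncard hss (Set.toFinite _)) hq rfl
      exact ⟨x, hsub hx⟩

/-- The internal vertex `v` separates the three leaves. -/
def Separates (v : T.IV) (x₀ x₁ xi : X) : Prop :=
  T.toward v x₀ ≠ T.toward v x₁ ∧ T.toward v x₀ ≠ T.toward v xi ∧ T.toward v x₁ ≠ T.toward v xi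

theorem exists_separates [Fintype X] (v : T.IV) : ∃ x₀ x₁ xi, T.Separates v x₀ x₁ xi := by
  obtain ⟨a, b, c, ha, hb, hc, hab, hac, hbc⟩ := (Set.two_lt_ncard_iff
    (Set.finite_of_ncard_pos (lt_of_lt_of_le (by norm_num) (T.stable v)))).1 (T.stable v)
  have h : ∀ p, T.graph.Adj (Sum.inr v) p → ∃ x, (T.toward v x).1 = p := fun p hp => by
    obtain ⟨x, hx⟩ := T.exists_leaf_mem_branch hp
    exact ⟨x, (T.toward_eq_iff v x hp).2 hx⟩
  obtain ⟨x, rfl⟩ := h a ha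
  obtain ⟨y, rfl⟩ := h b hb
  obtain ⟨z, rfl⟩ := h c hc
  exact ⟨x, y, z, fun h => hab (by rw [h]), fun h => hac (by rw [h]), fun h => hbc (by rw [h])⟩

/-- One step towards the common direction of `a` and `b` shortens two distances by one and lengthens
the third by at most one. The vertex reached is internal, since a leaf cannot carry both `a` and
`b`. -/
theorem dist_step {v : T.IV} {a b : X} (hab : a ≠ b) (h : T.toward v a = T.toward v b) (c : X) :
    ∃ v' : T.IV, T.graph.dist (Sum.inr v') (Sum.inl a) + T.graph.dist (Sum.inr v') (Sum.inl b) +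
      T.graph.dist (Sum.inr v') (Sum.inl c) <
      T.graph.dist (Sum.inr v) (Sum.inl a) + T.graph.dist (Sum.inr v) (Sum.inl b) +
      T.graph.dist (Sum.inr v) (Sum.inl c) := by
  have ha := T.mem_branch_toward v a
  have hb := T.mem_branch_toward v b
  rw [← h] at hb
  obtain ⟨⟨u, hu⟩, hu'⟩ : ∃ u, u = T.toward v a := ⟨_, rfl⟩
  rw [← hu'] at ha hb
  change T.graph.Adj _ _ at hu
  cases u with
  | inl x =>
    have h1 := T.branch_leaf hu ha
    have h2 := T.branch_leaf hu hb
    exact absurd (Sum.inl_injective (h1.trans h2.symm)) hab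
  | inr u =>
    refine ⟨u, ?_⟩
    have h1 := dist_of_mem_branch T.isTree hu ha
    have h2 := dist_of_mem_branch T.isTree hu hb
    have h3 : T.graph.dist (Sum.inr u) (Sum.inl c) ≤ T.graph.dist (Sum.inr u) (Sum.inr v) +
      T.graph.dist (Sum.inr v) (Sum.inl c) := T.isTree.1.dist_triangle
    have h4 : T.graph.dist (Sum.inr u) (Sum.inr v) = 1 :=
      SimpleGraph.dist_eq_one_iff_adj.2 hu.symm
    omega

/-- A vertex minimizing the sum of the distances to the three leaves separates them, by `dist_step`.
-/
theorem exists_separating [Fintype X] (hX : 3 ≤ Fintype.card X) {a b c : X} (hab : a ≠ b)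
    (hac : a ≠ c) (hbc : b ≠ c) : ∃ v, T.Separates v a b c := by
  obtain ⟨v₀, -⟩ := T.exists_adj_leaf hX a
  let d : T.IV → ℕ := fun v => T.graph.dist (Sum.inr v) (Sum.inl a) +
    T.graph.dist (Sum.inr v) (Sum.inl b) + T.graph.dist (Sum.inr v) (Sum.inl c)
  have : Nonempty T.IV := ⟨v₀⟩
  obtain ⟨v, hv⟩ : ∃ v, ∀ v', d v ≤ d v' := by
    have := T.finite_IV
    exact Finite.exists_min d
  refine ⟨v, fun h => ?_, fun h => ?_, fun h => ?_⟩
  · obtain ⟨v', hv'⟩ := T.dist_step hab h c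
    have := hv v'
    simp only [d] at this
    omega
  · obtain ⟨v', hv'⟩ := T.dist_step hac h b
    have := hv v'
    simp only [d] at this
    omega
  · obtain ⟨v', hv'⟩ := T.dist_step hbc h a
    have := hv v'
    simp only [d] at this
    omega

/-- Seen from `v'`, every leaf that does not lie on the side of `v'` at `v` appears in the single
direction of `v`. At most one of three leaves separated at `v` lies on the side of `v'`, so the
other two are not separated at `v'`. -/
theorem separates_unique {v v' : T.IV} {a b c : X} (h : T.Separates v a b c)
    (h' : T.Separates v' a b c) : v = v' := by
  classical
  by_contra hne
  have hne' : (Sum.inr v : X ⊕ T.IV) ≠ Sum.inr v' := by simpa using hne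
  obtain ⟨u, hu, hvu⟩ := exists_mem_branch T.isTree hne'
  obtain ⟨u', hu', hvu'⟩ := exists_mem_branch T.isTree hne'.symm
  have key : ∀ x, (T.toward v x).1 ≠ u → (T.toward v' x).1 = u' := fun x hx => by
    rw [T.toward_eq_iff v' x hu']
    have hadj : T.graph.Adj (Sum.inr v) (T.toward v x).1 := (T.toward v x).2
    obtain ⟨W, hW⟩ := T.mem_branch_toward v x
    refine branch_walk hvu' (SimpleGraph.Walk.cons hadj W) ?_
    rw [SimpleGraph.Walk.support_cons, List.mem_cons, not_or]
    refine ⟨hne'.symm, fun hmem => hx ?_⟩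
    refine eq_of_mem_branch T.isTree hadj hu ⟨W.takeUntil _ hmem, fun h' => hW ?_⟩ hvu
    exact W.support_takeUntil_subset_support hmem h'
  have key2 : ∀ x y, (T.toward v x).1 ≠ u → (T.toward v y).1 ≠ u → T.toward v' x = T.toward v' y :=
    fun x y hx hy => Subtype.ext ((key x hx).trans (key y hy).symm)
  obtain ⟨h1, h2, h3⟩ := h
  obtain ⟨h1', h2', h3'⟩ := h'
  by_cases ha : (T.toward v a).1 = u
  · exact h3' (key2 b c (fun hb => h1 (Subtype.ext (ha.trans hb.symm)))
      fun hc => h2 (Subtype.ext (ha.trans hc.symm)))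
  · by_cases hb : (T.toward v b).1 = u
    · exact h2' (key2 a c ha fun hc => h3 (Subtype.ext (hb.trans hc.symm)))
    · exact h1' (key2 a b ha hb)

end TreeOfSpheres

end

section

/-! ### Counting preimages in a branch -/

section Counting

variable {V U : Type*}

open Classical in
-- The edge `{a, b}` is the only one joining the branch to its complement. This is a discrete
-- boundary formula for the indicator of the branch.
theorem branch_indicator_sub {G : SimpleGraph V} (hG : G.IsTree) {a b p q : V} (hab : G.Adj a b)
    (hpq : G.Adj p q) :
    ((if p ∈ branch G a b then 1 else 0) - (if q ∈ branch G a b then 1 else 0) : ℤ) =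
      (if p = b ∧ q = a then 1 else 0) - (if p = a ∧ q = b then 1 else 0) := by
  have ha : a ∉ branch G a b := notMem_branch a b
  have hb : b ∈ branch G a b := self_mem_branch hab.ne
  by_cases hp : p ∈ branch G a b <;> by_cases hq : q ∈ branch G a b
  · have h1 : q ≠ a := fun h => ha (h ▸ hq)
    have h2 : p ≠ a := fun h => ha (h ▸ hp)
    simp [hp, hq, h1, h2]
  · have h1 : q = a := by
      by_contra h
      exact hq (branch_adj hp hpq h)
    subst h1
    have h2 := eq_of_adj_of_mem_branch hG hab hpq.symm hp
    simp [h2, ha, hb, hab.ne, hab.ne']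
  · have h1 : p = a := by
      by_contra h
      exact hp (branch_adj hq hpq.symm h)
    subst h1
    have h2 := eq_of_adj_of_mem_branch hG hab hpq hq
    simp [h2, ha, hb, hab.ne, hab.ne']
  · have h1 : q ≠ b := fun h => hq (h ▸ hb)
    have h2 : p ≠ b := fun h => hp (h ▸ hb)
    simp [hp, hq, h1, h2]

open Classical in
/-- Let `φ` be a map of trees with edge degrees `D` such that the edges at `p` above an edge at
`φ p` have total degree `n p`. The number of preimages of `x` in the branch at `a` towards `b`, minus
the degree of the edge `{a, b}` if `x` lies in the image branch, does not depend on `x`. -/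
theorem sum_branch_sub_eq [Fintype V] [DecidableEq U] {G : SimpleGraph V} {H : SimpleGraph U} (hG : G.IsTree)
    (hH : H.IsTree) {φ : V → U} (hφ : ∀ {p q}, G.Adj p q → H.Adj (φ p) (φ q)) {D : V → V → ℤ}
    (hsymm : ∀ p q, D p q = D q p) (hD : ∀ p q, ¬ G.Adj p q → D p q = 0) {n : V → ℤ}
    (hn : ∀ p x, H.Adj (φ p) x → ∑ q, (if φ q = x then D p q else 0) = n p) {a b : V}
    (hab : G.Adj a b) (x y : U) :
    (∑ p, if p ∈ branch G a b ∧ φ p = x then n p else 0) -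
        (if x ∈ branch H (φ a) (φ b) then D a b else 0) =
      (∑ p, if p ∈ branch G a b ∧ φ p = y then n p else 0) -
        (if y ∈ branch H (φ a) (φ b) then D a b else 0) := by
  have key : ∀ x y, H.Adj x y →
      (∑ p, if p ∈ branch G a b ∧ φ p = x then n p else 0) -
        (if x ∈ branch H (φ a) (φ b) then D a b else 0) =
      (∑ p, if p ∈ branch G a b ∧ φ p = y then n p else 0) -
        (if y ∈ branch H (φ a) (φ b) then D a b else 0) := by
    intro x y hxy
    -- Spread the weight `n p` of a vertex above `x` over the edges at `p` lying above the edge `{x,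
    -- y}`. The sums over `x` and over `y` then run over the same edges, counted from opposite
    -- endpoints.
    have h1 : ∀ x y, H.Adj x y → (∑ p, if p ∈ branch G a b ∧ φ p = x then n p else 0) =
        ∑ p, ∑ q, (if p ∈ branch G a b then 1 else 0) *
          (if φ p = x ∧ φ q = y then D p q else 0) := by
      intro x y hxy
      refine Finset.sum_congr rfl fun p _ => ?_
      by_cases hp : p ∈ branch G a b <;> by_cases hx : φ p = x
      · subst hx
        simp [hp, hn p y hxy]
      · simp [hx]
      · simp [hp]
      · simp [hp]
    have h2 : (∑ p, if p ∈ branch G a b ∧ φ p = y then n p else 0) =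
        ∑ p, ∑ q, (if q ∈ branch G a b then 1 else 0) *
          (if φ p = x ∧ φ q = y then D p q else 0) := by
      rw [h1 y x hxy.symm, Finset.sum_comm]
      refine Finset.sum_congr rfl fun p _ => Finset.sum_congr rfl fun q _ => ?_
      simp only [hsymm q p, and_comm (a := φ q = y)]
    -- An edge with both ends in the branch, or neither, cancels. Only `{a, b}` survives, in its two
    -- orientations.
    have h3 : (∑ p, ∑ q, (if p ∈ branch G a b then 1 else 0) *
          (if φ p = x ∧ φ q = y then D p q else 0)) -
        ∑ p, ∑ q, (if q ∈ branch G a b then 1 else 0) *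
          (if φ p = x ∧ φ q = y then D p q else 0) =
        ∑ p, ∑ q, ((if p = b ∧ q = a then (if φ b = x ∧ φ a = y then D a b else 0) else 0) -
          (if p = a ∧ q = b then (if φ a = x ∧ φ b = y then D a b else 0) else 0)) := by
      simp only [← Finset.sum_sub_distrib, ← sub_mul]
      refine Finset.sum_congr rfl fun p _ => Finset.sum_congr rfl fun q _ => ?_
      by_cases hpq : G.Adj p q
      · rw [branch_indicator_sub hG hab hpq]
        by_cases e1 : p = b ∧ q = a
        · obtain ⟨rfl, rfl⟩ := e1
          simp [hpq.ne, hsymm p q]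
        · by_cases e2 : p = a ∧ q = b
          · obtain ⟨rfl, rfl⟩ := e2
            simp only [if_neg e1, and_self, if_true]
            ring
          · simp [e1, e2]
      · have e1 : ¬ (p = b ∧ q = a) := by
          rintro ⟨rfl, rfl⟩
          exact hpq hab.symm
        have e2 : ¬ (p = a ∧ q = b) := by
          rintro ⟨rfl, rfl⟩
          exact hpq hab
        simp [hD p q hpq, e1, e2]
    have h4 : ∀ (i j : V) (t : ℤ), ∑ p, ∑ q, (if p = i ∧ q = j then t else 0) = t := by
      intro i j t
      rw [Finset.sum_eq_single i, Finset.sum_eq_single j]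
      · simp
      · intro q _ hq; simp [hq]
      · simp
      · intro p _ hp; simp [hp]
      · simp
    simp only [Finset.sum_sub_distrib, h4] at h3
    have h5 := branch_indicator_sub hH (hφ hab) hxy
    rw [← h1 x y hxy, ← h2] at h3
    have h6 : ∀ (c : Prop) [Decidable c], (if c then D a b else 0) = (if c then 1 else 0) * D a b := by
      intro c _; split_ifs <;> simp
    rw [h6 (φ b = x ∧ φ a = y), h6 (φ a = x ∧ φ b = y)] at h3
    rw [h6 (x ∈ _), h6 (y ∈ _)]
    simp only [eq_comm (a := x), eq_comm (a := y)] at h5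
    linear_combination h3 - D a b * h5
  -- The invariance under passing to a neighbour propagates along a walk from `x` to `y`.
  obtain ⟨W⟩ := hH.1.preconnected x y
  induction W with
  | nil => rfl
  | cons h _ ih => exact (key _ _ h).trans ih

end Counting

/-! ### Existence of charts -/

theorem proj_eq_proj {a b c d : ℂ} (h : a ≠ 0 ∨ b ≠ 0) (h' : c ≠ 0 ∨ d ≠ 0)
    (hd : a * d - b * c = 0) : proj a b = proj c d := by
  by_cases hb : b = 0
  · subst hb
    have ha : a ≠ 0 := by simpa using h
    have : d = 0 := by simpa [ha] using hd
    rw [this, proj_zero_right, proj_zero_right]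
  · by_cases hd0 : d = 0
    · subst hd0
      have : c = 0 := by simpa [hb] using hd
      simp [this] at h'
    · rw [proj_of_ne hb, proj_of_ne hd0]
      congr 1
      field_simp
      linear_combination hd

theorem exists_proj (x : RSphere) : ∃ a b : ℂ, (a ≠ 0 ∨ b ≠ 0) ∧ x = proj a b :=
  ⟨_, _, param_ne x 0, by rw [← param_eq_proj, param_zero]⟩

theorem exists_smul_proj {a b c d : ℂ} (h : a * d - b * c ≠ 0) :
    ∃ g : Matrix.GeneralLinearGroup (Fin 2) ℂ, ∀ x y : ℂ, x ≠ 0 ∨ y ≠ 0 →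
      g • proj x y = proj (a * x + b * y) (c * x + d * y) := by
  have hM : (!![a, b; c, d] : Matrix (Fin 2) (Fin 2) ℂ).det ≠ 0 := by
    rwa [Matrix.det_fin_two_of]
  refine ⟨Matrix.GeneralLinearGroup.mkOfDetNeZero _ hM, fun x y hxy => ?_⟩
  rw [smul_proj _ hxy]
  rfl

theorem exists_smul_eq_zero_one_infty {p q r : RSphere} (hpq : p ≠ q) (hpr : p ≠ r) (hqr : q ≠ r) :
    ∃ g : Matrix.GeneralLinearGroup (Fin 2) ℂ, g • p = ((0 : ℂ) : OnePoint ℂ) ∧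
      g • q = ((1 : ℂ) : OnePoint ℂ) ∧ g • r = OnePoint.infty := by
  obtain ⟨a, b, hab, rfl⟩ := exists_proj p
  obtain ⟨c, d, hcd, rfl⟩ := exists_proj q
  obtain ⟨e, f, hef, rfl⟩ := exists_proj r
  have h1 : a * d - b * c ≠ 0 := fun h => hpq (proj_eq_proj hab hcd h)
  have h2 : a * f - b * e ≠ 0 := fun h => hpr (proj_eq_proj hab hef h)
  have h3 : c * f - d * e ≠ 0 := fun h => hqr (proj_eq_proj hcd hef h)
  -- The matrix of the cross-ratio `[x, p] [q, r] / ([x, r] [q, p])`, where `[·, ·]` is the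
  -- determinant of homogeneous coordinates.
  obtain ⟨g, hg⟩ := exists_smul_proj (a := (c * f - d * e) * b) (b := -((c * f - d * e) * a))
    (c := (c * b - d * a) * f) (d := -((c * b - d * a) * e)) (by
      intro h
      apply mul_ne_zero (mul_ne_zero h3 h1) h2
      linear_combination -h)
  refine ⟨g, ?_, ?_, ?_⟩
  · rw [hg _ _ hab, proj_of_ne]
    · congr 1
      rw [div_eq_zero_iff]
      left; ring
    · intro h
      apply mul_ne_zero h1 h2
      linear_combination -h
  · have h4 : (c * b - d * a) * f * c + -((c * b - d * a) * e) * d ≠ 0 := by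
      intro h
      apply mul_ne_zero h1 h3
      linear_combination -h
    rw [hg _ _ hcd, proj_of_ne h4]
    congr 1
    rw [div_eq_one_iff_eq h4]
    ring
  · have h4 : (c * b - d * a) * f * e + -((c * b - d * a) * e) * f = 0 := by ring
    rw [hg _ _ hef, h4, proj_zero_right]

theorem ProjSphere.exists_chart_three (S : ProjSphere.{w}) {p q r : S} (hpq : p ≠ q) (hpr : p ≠ r)
    (hqr : q ≠ r) : ∃ σ ∈ S.charts, σ p = ((0 : ℂ) : OnePoint ℂ) ∧
      σ q = ((1 : ℂ) : OnePoint ℂ) ∧ σ r = OnePoint.infty := by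
  obtain ⟨g, h0, h1, hi⟩ := exists_smul_eq_zero_one_infty (S.chart.injective.ne hpq)
    (S.chart.injective.ne hpr) (S.chart.injective.ne hqr)
  exact ⟨_, S.trans_moebius_mem S.chart_mem g, h0, h1, hi⟩

instance (S : ProjSphere.{w}) : Infinite S :=
  haveI : Infinite RSphere := Infinite.of_injective _ (OnePoint.coe_injective (X := ℂ))
  Infinite.of_injective _ S.chart.symm.injective

theorem ProjSphere.exists_chart_two (S : ProjSphere.{w}) {p r : S} (hpr : p ≠ r) :
    ∃ σ ∈ S.charts, σ p = ((0 : ℂ) : OnePoint ℂ) ∧ σ r = OnePoint.infty := by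
  classical
  obtain ⟨q, hq⟩ := Infinite.exists_notMem_finset ({p, r} : Finset S)
  simp only [Finset.mem_insert, Finset.mem_singleton, not_or] at hq
  obtain ⟨σ, hσ, h0, -, hi⟩ := S.exists_chart_three (Ne.symm hq.1) hpr hq.2
  exact ⟨σ, hσ, h0, hi⟩

theorem ProjSphere.exists_chart_finite (S : ProjSphere.{w}) {s : Set S} (hs : s.Finite) :
    ∃ σ ∈ S.charts, ∀ x ∈ s, σ x ≠ OnePoint.infty := by
  obtain ⟨r, hr⟩ := hs.exists_notMem
  obtain ⟨p, hp⟩ := exists_ne r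
  obtain ⟨σ, hσ, -, hi⟩ := S.exists_chart_two hp
  refine ⟨σ, hσ, fun x hx h => hr ?_⟩
  rwa [← σ.injective (h.trans hi.symm)]

/-! ### The maps between spheres in coordinates -/

theorem TreeOfSpheres.finite_neighborSet {X : Type u} (T : TreeOfSpheres.{u, v, w} X) (v : T.IV) :
    (T.graph.neighborSet (Sum.inr v)).Finite :=
  Set.finite_of_ncard_pos (lt_of_lt_of_le (by norm_num) (T.stable v))

theorem TreeOfSpheres.finite_attachSet {X : Type u} (T : TreeOfSpheres.{u, v, w} X) (v : T.IV) :
    (T.attachSet v).Finite := by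
  have := (T.finite_neighborSet v).to_subtype
  exact Set.finite_range _

theorem IsHolomorphic.continuous {S S' : ProjSphere.{w}} {f : S → S'} (hf : IsHolomorphic f) :
    Continuous f := by
  have h := (hf _ S.chart_mem _ S'.chart_mem).1
  have : f = fun x => S'.chart.symm (S'.chart (f (S.chart.symm (S.chart x)))) := by
    funext x; simp
  rw [this]
  exact S'.chart.symm.continuous.comp (h.comp S.chart.continuous)

variable {Y Z : Type u}

namespace Cover

variable {TY : TreeOfSpheres.{u, v, w} Y} {TZ : TreeOfSpheres.{u, v, w} Z} (f : Cover TY TZ)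

/-- The covering condition sends non-attaching points to non-attaching points, so the fibre above an
attaching point consists of attaching points only. Hence all zeros and poles used below are at
edges. -/
theorem exists_attach_eq (v : TY.IV) {x : TY.sphere v} {e' : TZ.graph.neighborSet _}
    (h : f.map v x = TZ.attach (f.vertexMap v) e') :
    ∃ e, TY.attach v e = x ∧ Sum.map f.leafMap f.vertexMap e.1 = e'.1 := by
  obtain ⟨hm, -⟩ := f.covering v
  by_cases hx : x ∈ TY.attachSet v
  · obtain ⟨e, rfl⟩ := hx
    refine ⟨e, rfl, ?_⟩
    rw [f.map_attach] at h
    exact congrArg Subtype.val (TZ.attach_injective _ h)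
  · exact absurd ⟨e', h.symm⟩ (hm hx)

theorem map_attach_eq_iff (v : TY.IV) (e : TY.graph.neighborSet (Sum.inr v))
    (e' : TZ.graph.neighborSet (Sum.inr (f.vertexMap v))) :
    f.map v (TY.attach v e) = TZ.attach (f.vertexMap v) e' ↔
      Sum.map f.leafMap f.vertexMap e.1 = e'.1 := by
  rw [f.map_attach, (TZ.attach_injective _).eq_iff, Subtype.ext_iff]

open Classical in
/-- In coordinates, `f_v` is the rational function whose divisor is given by the edges above two
edges `e₀` and `e₁`. -/
theorem eq_prod_edges [DecidableEq (Z ⊕ TZ.IV)] (v : TY.IV) [Fintype (TY.graph.neighborSet (Sum.inr v))]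
    {e₀ e₁ : TZ.graph.neighborSet (Sum.inr (f.vertexMap v))}
    {σ : TY.sphere v ≃ₜ RSphere} (hσ : σ ∈ (TY.sphere v).charts)
    (hfin : ∀ e, σ (TY.attach v e) ≠ OnePoint.infty)
    {τ : TZ.sphere (f.vertexMap v) ≃ₜ RSphere} (hτ : τ ∈ (TZ.sphere (f.vertexMap v)).charts)
    (h0 : τ (TZ.attach _ e₀) = ((0 : ℂ) : OnePoint ℂ)) (h1 : τ (TZ.attach _ e₁) = OnePoint.infty)
    {D : TY.graph.neighborSet (Sum.inr v) → ℤ}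
    (hD : ∀ e, D e = localDegree (f.map v) (TY.attach v e) *
      ((if Sum.map f.leafMap f.vertexMap e.1 = e₀.1 then 1 else 0) -
        (if Sum.map f.leafMap f.vertexMap e.1 = e₁.1 then 1 else 0))) :
    ∑ e, D e = 0 ∧ ∃ c : ℂ, c ≠ 0 ∧ ∀ x : ℂ, σ.symm x ∉ TY.attachSet v →
      τ (f.map v (σ.symm x)) =
        ((c * ∏ e, (x - toC (σ (TY.attach v e))) ^ D e : ℂ) : OnePoint ℂ) := by
  have hinj : Function.Injective fun e => toC (σ (TY.attach v e)) := fun e e' h => by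
    refine TY.attach_injective v (σ.injective ?_)
    rw [← coe_toC (hfin e), ← coe_toC (hfin e')]
    exact congrArg _ h
  have hco : ∀ e, σ.symm ((toC (σ (TY.attach v e)) : ℂ) : OnePoint ℂ) = TY.attach v e := fun e => by
    rw [coe_toC (hfin e), Homeomorph.symm_apply_apply]
  have hne : e₀.1 ≠ e₁.1 := fun h => by
    rw [Subtype.ext h, h1] at h0
    exact OnePoint.infty_ne_coe _ h0
  have hz : ∀ e, τ (f.map v (TY.attach v e)) = ((0 : ℂ) : OnePoint ℂ) ↔
      Sum.map f.leafMap f.vertexMap e.1 = e₀.1 := fun e => by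
    rw [← h0, τ.injective.eq_iff, f.map_attach_eq_iff]
  have hp : ∀ e, τ (f.map v (TY.attach v e)) = OnePoint.infty ↔
      Sum.map f.leafMap f.vertexMap e.1 = e₁.1 := fun e => by
    rw [← h1, τ.injective.eq_iff, f.map_attach_eq_iff]
  let E : Finset (TY.graph.neighborSet (Sum.inr v)) :=
    Finset.univ.filter fun e => Sum.map f.leafMap f.vertexMap e.1 = e₀.1 ∨
      Sum.map f.leafMap f.vertexMap e.1 = e₁.1
  have hex : ∀ x, τ (f.map v x) = ((0 : ℂ) : OnePoint ℂ) ∨ τ (f.map v x) = OnePoint.infty →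
      ∃ e ∈ E, TY.attach v e = x := by
    rintro x (h | h)
    · rw [← h0, τ.injective.eq_iff] at h
      obtain ⟨e, he, he'⟩ := f.exists_attach_eq v h
      exact ⟨e, by simp [E, he'], he⟩
    · rw [← h1, τ.injective.eq_iff] at h
      obtain ⟨e, he, he'⟩ := f.exists_attach_eq v h
      exact ⟨e, by simp [E, he'], he⟩
  let F : RSphere → RSphere := fun x => τ (f.map v (σ.symm x))
  let D' : ℂ → ℤ := fun x => if F x = ((0 : ℂ) : OnePoint ℂ) then localDeg F x else
    if F x = OnePoint.infty then -localDeg F x else 0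
  have hFe : ∀ e, F (toC (σ (TY.attach v e)) : OnePoint ℂ) = τ (f.map v (TY.attach v e)) :=
    fun e => by simp only [F, hco]
  have hDe : ∀ e, D' (toC (σ (TY.attach v e))) = D e := fun e => by
    have hloc : localDegree (f.map v) (TY.attach v e) =
        localDeg F (toC (σ (TY.attach v e)) : OnePoint ℂ) := by
      rw [localDegree_eq (f.holomorphic v) hσ hτ, coe_toC (hfin e)]
    simp only [D', hFe, hz, hp, hD, hloc]
    by_cases c0 : Sum.map f.leafMap f.vertexMap e.1 = e₀.1
    · simp [c0, hne]
    · by_cases c1 : Sum.map f.leafMap f.vertexMap e.1 = e₁.1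
      · simp [c1, hne.symm]
      · simp [c0, c1]
  have hDE : ∀ e ∉ E, D e = 0 := fun e he => by
    simp only [E, Finset.mem_filter, Finset.mem_univ, true_and, not_or] at he
    simp [hD, he.1, he.2]
  -- In the chart `σ` no attaching point is at `∞`, so `F` has neither a zero nor a pole there, as
  -- required for the product formula over `ℂ`.
  have hinf : ∀ e ∈ E, TY.attach v e ≠ σ.symm OnePoint.infty := fun e _ h =>
    hfin e (by rw [h, Homeomorph.apply_symm_apply])
  have key := (f.holomorphic v σ hσ τ hτ).eq_prod
    (A := E.image fun e => toC (σ (TY.attach v e))) (D := D') ?_ ?_ ?_ ?_ ?_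
  · obtain ⟨hs, c, hc, hF⟩ := key
    rw [Finset.sum_image hinj.injOn] at hs
    refine ⟨?_, c, hc, fun x hx => ?_⟩
    · rw [← hs]
      simp only [hDe]
      exact (Finset.sum_subset (Finset.subset_univ E) fun e _ he => hDE e he).symm
    · rw [hF x, Finset.prod_image hinj.injOn]
      · simp only [hDe]
        rw [Finset.prod_subset (Finset.subset_univ E)]
        intro e _ he
        rw [hDE e he, zpow_zero]
      · intro hx'
        obtain ⟨e, -, rfl⟩ := Finset.mem_image.1 hx'
        exact hx ⟨e, (hco e).symm⟩
  · intro x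
    rw [Finset.mem_image]
    constructor
    · rintro ⟨e, he, rfl⟩
      rw [hco, hz, hp]
      exact (Finset.mem_filter.1 he).2
    · intro h
      obtain ⟨e, he, h'⟩ := hex _ h
      refine ⟨e, he, ?_⟩
      rw [h', Homeomorph.apply_symm_apply, toC_coe]
  · intro h
    obtain ⟨e, he, h'⟩ := hex _ (Or.inl h)
    exact hinf e he h'
  · intro h
    obtain ⟨e, he, h'⟩ := hex _ (Or.inr h)
    exact hinf e he h'
  · intro x hx
    exact if_pos hx
  · intro x hx
    replace hx : F x = OnePoint.infty := hx
    exact (if_neg (by rw [hx]; exact OnePoint.infty_ne_coe _)).trans (if_pos hx)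

open Classical in
-- The divisor of a rational function has total degree `0`; equivalently, the fibres of `f_v` above
-- two attaching points have the same number of points with multiplicity.
theorem sum_degree_eq [DecidableEq (Z ⊕ TZ.IV)] (v : TY.IV) [Fintype (TY.graph.neighborSet (Sum.inr v))]
    (e₀ e₁ : TZ.graph.neighborSet (Sum.inr (f.vertexMap v))) :
    ∑ e, (if Sum.map f.leafMap f.vertexMap e.1 = e₀.1 then
        (localDegree (f.map v) (TY.attach v e) : ℤ) else 0) =
      ∑ e, (if Sum.map f.leafMap f.vertexMap e.1 = e₁.1 then
        (localDegree (f.map v) (TY.attach v e) : ℤ) else 0) := by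
  by_cases h : e₀ = e₁
  · rw [h]
  obtain ⟨σ, hσ, hfin⟩ := (TY.sphere v).exists_chart_finite (TY.finite_attachSet v)
  obtain ⟨τ, hτ, h0, h1⟩ := (TZ.sphere (f.vertexMap v)).exists_chart_two
    ((TZ.attach_injective _).ne h)
  have := (f.eq_prod_edges v hσ (fun e => hfin _ ⟨e, rfl⟩) hτ h0 h1 fun e => rfl).1
  simp only [mul_sub, Finset.sum_sub_distrib, mul_ite, mul_one, mul_zero] at this
  linarith

end Cover

end

section

/-! ### Covers in coordinates: the divisor is given by the leaves -/

variable {Y Z : Type u} [Fintype Y] [DecidableEq Z] {P : Portrait Y Z}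

namespace MarkedCover

variable (C : MarkedCover.{u, v, w} P)

open Classical in
/-- The degree of the edge `{p, q}`, and `0` if `p` and `q` are not adjacent. -/
def edgeDeg : Y ⊕ C.source.IV → Y ⊕ C.source.IV → ℕ
  | Sum.inl y, q => if C.source.graph.Adj (Sum.inl y) q then P.deg y else 0
  | Sum.inr v, q => if h : C.source.graph.Adj (Sum.inr v) q then
      localDegree (C.cover.map v) (C.source.attach v ⟨q, h⟩) else 0

theorem edgeDeg_of_not_adj {p q : Y ⊕ C.source.IV} (h : ¬ C.source.graph.Adj p q) :
    C.edgeDeg p q = 0 := by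
  cases p <;> simp [edgeDeg, h]

theorem edgeDeg_attach (v : C.source.IV) (e : C.source.graph.neighborSet (Sum.inr v)) :
    C.edgeDeg (Sum.inr v) e.1 = localDegree (C.cover.map v) (C.source.attach v e) := by
  have h : C.source.graph.Adj (Sum.inr v) e.1 := e.2
  simp [edgeDeg, h]

theorem edgeDeg_symm (hY : 3 ≤ Fintype.card Y) (p q : Y ⊕ C.source.IV) :
    C.edgeDeg p q = C.edgeDeg q p := by
  by_cases h : C.source.graph.Adj p q
  · cases p with
    | inl y =>
      cases q with
      | inl y' =>
        obtain ⟨v, hv⟩ := C.source.exists_adj_leaf hY y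
        exact absurd (C.source.eq_of_adj_leaf h hv) Sum.inl_ne_inr
      | inr v =>
        rw [C.edgeDeg_attach v ⟨Sum.inl y, h.symm⟩, C.hasPortrait.2 y v h.symm]
        simp [edgeDeg, h]
    | inr v =>
      cases q with
      | inl y =>
        rw [C.edgeDeg_attach v ⟨Sum.inl y, h⟩, C.hasPortrait.2 y v h]
        simp [edgeDeg, h.symm]
      | inr v' =>
        rw [C.edgeDeg_attach v ⟨_, h⟩, C.edgeDeg_attach v' ⟨_, h.symm⟩]
        exact C.cover.edge_degree v v' h
  · rw [C.edgeDeg_of_not_adj h, C.edgeDeg_of_not_adj fun h' => h h'.symm]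

open Classical in
-- This is `sum_branch_sub_eq` for the tree map, compared at two leaves of the target: counting
-- leaves of the branch above `z₀` and above `z₁` with their degrees, the difference only sees
-- whether the image edge points to `z₀` or to `z₁`. It says which multiplicity results at the
-- attaching point of `e` when all marked points of the branch merge there.
theorem sum_leaves_eq (hY : 3 ≤ Fintype.card Y) (v : C.source.IV)
    (e : C.source.graph.neighborSet (Sum.inr v)) (z₀ z₁ : Z) :
    ∑ y with C.source.toward v y = e,
        (P.deg y : ℤ) * ((if P.F y = z₀ then 1 else 0) - (if P.F y = z₁ then 1 else 0)) =
      localDegree (C.cover.map v) (C.source.attach v e) *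
      ((if Sum.map C.cover.leafMap C.cover.vertexMap e.1 =
          (C.target.toward (C.cover.vertexMap v) z₀).1 then 1 else 0) -
        (if Sum.map C.cover.leafMap C.cover.vertexMap e.1 =
          (C.target.toward (C.cover.vertexMap v) z₁).1 then 1 else 0)) := by
  have := C.source.finite_IV
  let _ : Fintype C.source.IV := Fintype.ofFinite _
  let φ : Y ⊕ C.source.IV → Z ⊕ C.target.IV := Sum.map C.cover.leafMap C.cover.vertexMap
  have hφ : ∀ {p q}, C.source.graph.Adj p q → C.target.graph.Adj (φ p) (φ q) := C.cover.adj
  -- The weight `n p` is the degree of the cover at `p`: the portrait degree at a leaf, which has a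
  -- single edge, and the degree of `f_v` at an internal vertex, well defined by `sum_degree_eq`.
  have hn : ∀ p, ∃ n : ℤ, (∀ x, C.target.graph.Adj (φ p) x →
      ∑ q, (if φ q = x then (C.edgeDeg p q : ℤ) else 0) = n) ∧ ∀ y, p = Sum.inl y → n = P.deg y := by
    intro p
    cases p with
    | inl y =>
      refine ⟨P.deg y, fun x hx => ?_, fun y' h => by rw [Sum.inl_injective h]⟩
      obtain ⟨v, hv⟩ := C.source.exists_adj_leaf hY y
      have hx' : φ (Sum.inr v) = x := C.target.eq_of_adj_leaf (hφ hv) hx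
      rw [Finset.sum_eq_single (Sum.inr v)]
      · simp [hx', edgeDeg, hv]
      · intro q _ hq
        have : ¬ C.source.graph.Adj (Sum.inl y) q := fun h => hq (C.source.eq_of_adj_leaf h hv)
        simp [C.edgeDeg_of_not_adj this]
      · simp
    | inr v =>
      have hsum : ∀ x, ∑ q, (if φ q = x then (C.edgeDeg (Sum.inr v) q : ℤ) else 0) =
          ∑ e : C.source.graph.neighborSet (Sum.inr v), (if φ e.1 = x then
            (localDegree (C.cover.map v) (C.source.attach v e) : ℤ) else 0) := by
        intro x
        rw [← Finset.sum_subset (Finset.subset_univ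
          (Finset.univ.filter fun q => q ∈ C.source.graph.neighborSet (Sum.inr v)))]
        · rw [Finset.sum_subtype (p := fun q => q ∈ C.source.graph.neighborSet (Sum.inr v)) _
            (by simp)]
          refine Finset.sum_congr rfl fun e _ => ?_
          rw [C.edgeDeg_attach]
        · intro q _ hq
          have : ¬ C.source.graph.Adj (Sum.inr v) q := by simpa using hq
          simp [C.edgeDeg_of_not_adj this]
      obtain ⟨e', he'⟩ : (C.source.graph.neighborSet (Sum.inr v)).Nonempty :=
        Set.nonempty_of_ncard_ne_zero (by have := C.source.stable v; omega)
      refine ⟨∑ e : C.source.graph.neighborSet (Sum.inr v), (if φ e.1 = φ e' then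
        (localDegree (C.cover.map v) (C.source.attach v e) : ℤ) else 0), fun x hx => ?_,
        fun y h => absurd h Sum.inr_ne_inl⟩
      rw [hsum]
      exact C.cover.sum_degree_eq v ⟨x, hx⟩ ⟨φ e', hφ he'⟩
  choose n hn hn' using hn
  have hadj : C.source.graph.Adj (Sum.inr v) e.1 := e.2
  have key := sum_branch_sub_eq C.source.isTree C.target.isTree hφ
    (D := fun p q => (C.edgeDeg p q : ℤ)) (fun p q => by rw [C.edgeDeg_symm hY])
    (fun p q h => by rw [C.edgeDeg_of_not_adj h]; rfl) hn hadj (Sum.inl z₀) (Sum.inl z₁)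
  have hleaf : ∀ z : Z, (∑ p, if p ∈ branch C.source.graph (Sum.inr v) e.1 ∧ φ p = Sum.inl z
      then n p else 0) =
      ∑ y with C.source.toward v y = e, (P.deg y : ℤ) * (if P.F y = z then 1 else 0) := by
    intro z
    rw [Fintype.sum_sum_type, Finset.sum_filter]
    have h2 : ∀ u : C.source.IV, φ (Sum.inr u) ≠ Sum.inl z := fun u => Sum.inr_ne_inl
    simp only [h2, and_false, if_false, Finset.sum_const_zero, add_zero]
    refine Finset.sum_congr rfl fun y _ => ?_
    have h3 : C.source.toward v y = e ↔ Sum.inl y ∈ branch C.source.graph (Sum.inr v) e.1 := by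
      rw [← C.source.toward_eq_iff v y hadj, Subtype.ext_iff]
    have h4 : φ (Sum.inl y) = Sum.inl z ↔ P.F y = z := by
      rw [← C.hasPortrait.1]
      exact Sum.inl_injective.eq_iff
    simp only [h3, h4, hn' _ y rfl]
    by_cases c1 : Sum.inl y ∈ branch C.source.graph (Sum.inr v) e.1 <;>
      by_cases c2 : P.F y = z <;> simp [c1, c2]
  have hbr : ∀ z : Z, Sum.inl z ∈ branch C.target.graph (φ (Sum.inr v)) (φ e.1) ↔
      φ e.1 = (C.target.toward (C.cover.vertexMap v) z).1 := fun z => by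
    rw [eq_comm]
    exact (C.target.toward_eq_iff (C.cover.vertexMap v) z (hφ hadj)).symm
  simp only [hleaf, hbr, C.edgeDeg_attach] at key
  simp only [mul_sub, Finset.sum_sub_distrib]
  have h6 : ∀ (c : Prop) [Decidable c] (t : ℤ), (if c then t else 0) = t * (if c then 1 else 0) := by
    intro c _ t; split_ifs <;> simp
  rw [h6 (φ e.1 = (C.target.toward (C.cover.vertexMap v) z₀).1),
    h6 (φ e.1 = (C.target.toward (C.cover.vertexMap v) z₁).1)] at key
  linear_combination key

open Classical in
/-- In coordinates, `f_v` is the rational function whose divisor is given by the leaves above two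
leaves `z₀` and `z₁`. -/
theorem eq_prod_leaves (hY : 3 ≤ Fintype.card Y) (v : C.source.IV) {z₀ z₁ : Z}
    {σ : C.source.sphere v ≃ₜ RSphere} (hσ : σ ∈ (C.source.sphere v).charts)
    (hfin : ∀ x ∈ C.source.attachSet v, σ x ≠ OnePoint.infty)
    {τ : C.target.sphere (C.cover.vertexMap v) ≃ₜ RSphere}
    (hτ : τ ∈ (C.target.sphere (C.cover.vertexMap v)).charts)
    (h0 : τ (C.target.a _ z₀) = ((0 : ℂ) : OnePoint ℂ))
    (h1 : τ (C.target.a _ z₁) = OnePoint.infty) :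
    ∃ c : ℂ, c ≠ 0 ∧ ∀ x : ℂ, σ.symm x ∉ C.source.attachSet v →
      τ (C.cover.map v (σ.symm x)) =
        ((c * ∏ y, (x - toC (σ (C.source.a v y))) ^ ((P.deg y : ℤ) *
          ((if P.F y = z₀ then 1 else 0) - (if P.F y = z₁ then 1 else 0))) : ℂ) : OnePoint ℂ) := by
  have := (C.source.finite_neighborSet v).to_subtype
  let _ : Fintype (C.source.graph.neighborSet (Sum.inr v)) := Fintype.ofFinite _
  obtain ⟨-, c, hc, h⟩ := C.cover.eq_prod_edges v hσ (fun e => hfin _ ⟨e, rfl⟩) hτ h0 h1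
    fun e => rfl
  refine ⟨c, hc, fun x hx => ?_⟩
  rw [h x hx]
  congr 2
  rw [← Finset.prod_fiberwise (s := Finset.univ) (g := fun y => C.source.toward v y)]
  refine Finset.prod_congr rfl fun e _ => ?_
  have hne : x - toC (σ (C.source.attach v e)) ≠ 0 := by
    intro h0
    apply hx
    rw [sub_eq_zero.1 h0, coe_toC (hfin _ ⟨e, rfl⟩), Homeomorph.symm_apply_apply]
    exact ⟨e, rfl⟩
  -- All leaves of one branch share the point `attach v e`, so their exponents add. Exponents of
  -- both signs occur, which is why the base must be nonzero.
  rw [← C.sum_leaves_eq hY v e z₀ z₁, zpow_sum₀ hne]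
  refine Finset.prod_congr rfl fun y hy => ?_
  rw [TreeOfSpheres.a, (Finset.mem_filter.1 hy).2]

end MarkedCover

end

section

/-! ### Convergence of the maps between spheres -/

theorem exists_smul_sub (ζ : ℂ) : ∃ g : Matrix.GeneralLinearGroup (Fin 2) ℂ,
    (∀ x : ℂ, g • (x : OnePoint ℂ) = ((x - ζ : ℂ) : OnePoint ℂ)) ∧
      g • (OnePoint.infty : OnePoint ℂ) = OnePoint.infty := by
  obtain ⟨g, hg⟩ := exists_smul_proj (a := 1) (b := -ζ) (c := 0) (d := 1) (by simp)
  refine ⟨g, fun x => ?_, ?_⟩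
  · have := hg x 1 (by simp)
    rw [proj_one] at this
    rw [this, ← proj_one]
    congr 1 <;> ring
  · have := hg 1 0 (by simp)
    rw [proj_zero_right] at this
    rw [this]
    simp [proj]

theorem exists_smul_inv : ∃ g : Matrix.GeneralLinearGroup (Fin 2) ℂ,
    ∀ a b : ℂ, a ≠ 0 ∨ b ≠ 0 → g • proj a b = proj b a := by
  obtain ⟨g, hg⟩ := exists_smul_proj (a := 0) (b := 1) (c := 1) (d := 0) (by simp)
  exact ⟨g, fun a b h => by simpa using hg a b h⟩

instance (S : ProjSphere.{w}) (x : S) : NeBot (𝓝[≠] x) := by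
  rw [← mem_closure_iff_nhdsWithin_neBot]
  have h : S.chart x ∈ closure {S.chart x}ᶜ := mem_closure_iff_nhdsWithin_neBot.2 inferInstance
  have h2 := mem_closure_image S.chart.symm.continuous.continuousAt h
  rw [Homeomorph.symm_apply_apply] at h2
  refine closure_mono ?_ h2
  rintro _ ⟨y, hy, rfl⟩ h
  exact hy (S.chart.toEquiv.symm_apply_eq.1 h)

variable {Y Z : Type u}

/-- The complement of the finite attaching set is dense, so a map constant there would be constant.
Two such points with distinct values supply the equations that determine the constants. -/
theorem Cover.exists_map_ne {TY : TreeOfSpheres.{u, v, w} Y} {TZ : TreeOfSpheres.{u, v, w} Z}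
    (f : Cover TY TZ) (v : TY.IV) (x : TY.sphere v) :
    ∃ x' ∉ TY.attachSet v, f.map v x ≠ f.map v x' := by
  by_contra! h
  have hd : Dense (univ \ TY.attachSet v) := dense_univ.sdiff_finite (TY.finite_attachSet v)
  have hc : Continuous (f.map v) := (f.holomorphic v).continuous
  have : ∀ x', f.map v x' = f.map v x := by
    refine fun x' => congrFun (Continuous.ext_on hd hc continuous_const fun x' hx' => ?_) x'
    exact (h x' hx'.2).symm
  obtain ⟨a, b, hab⟩ := f.nonconstant v
  exact hab ((this a).trans (this b).symm)

variable [Fintype Y] [DecidableEq Z] {P : Portrait Y Z}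

/-- The product of the `(x - η y) ^ deg y` over the leaves `y` above `z₀`, divided by the same
product over the leaves above `z₁`. -/
def leafProd (P : Portrait Y Z) (z₀ z₁ : Z) (η : Y → ℂ) (x : ℂ) : ℂ :=
  ∏ y, (x - η y) ^ ((P.deg y : ℤ) * ((if P.F y = z₀ then 1 else 0) - (if P.F y = z₁ then 1 else 0)))

theorem tendsto_leafProd {ι : Type*} {l : Filter ι} {z₀ z₁ : Z} {η : ι → Y → ℂ} {η' : Y → ℂ}
    {x : ι → ℂ} {x' : ℂ} (hη : ∀ y, Tendsto (fun i => η i y) l (𝓝 (η' y)))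
    (hx : Tendsto x l (𝓝 x')) (hne : ∀ y, x' ≠ η' y) :
    Tendsto (fun i => leafProd P z₀ z₁ (η i) (x i)) l (𝓝 (leafProd P z₀ z₁ η' x')) :=
  tendsto_finsetProd _ fun y _ => (hx.sub (hη y)).zpow₀ _ (Or.inl (sub_ne_zero.2 (hne y)))

/-- Both `f_v` and its translate by the value at `z` have the same poles, and each is a constant
times a `leafProd`. The resulting relation between the two products is what ties down the constants.
-/
theorem MarkedCover.exists_forms (C : MarkedCover.{u, v, w} P) (hY : 3 ≤ Fintype.card Y)
    (v : C.source.IV) {z₀ z₁ z : Z}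
    {σ : C.source.sphere v ≃ₜ RSphere} (hσ : σ ∈ (C.source.sphere v).charts)
    (hfin : ∀ x ∈ C.source.attachSet v, σ x ≠ OnePoint.infty)
    {τ : C.target.sphere (C.cover.vertexMap v) ≃ₜ RSphere}
    (hτ : τ ∈ (C.target.sphere (C.cover.vertexMap v)).charts)
    (h0 : τ (C.target.a _ z₀) = ((0 : ℂ) : OnePoint ℂ))
    (h1 : τ (C.target.a _ z₁) = OnePoint.infty) (hz : τ (C.target.a _ z) ≠ OnePoint.infty) :
    ∃ c c' : ℂ, ∀ x : ℂ, σ.symm x ∉ C.source.attachSet v →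
      τ (C.cover.map v (σ.symm x)) =
        ((c * leafProd P z₀ z₁ (fun y => toC (σ (C.source.a v y))) x : ℂ) : OnePoint ℂ) ∧
      c * leafProd P z₀ z₁ (fun y => toC (σ (C.source.a v y))) x - toC (τ (C.target.a _ z)) =
        c' * leafProd P z z₁ (fun y => toC (σ (C.source.a v y))) x := by
  obtain ⟨c, -, hc⟩ := C.eq_prod_leaves hY v hσ hfin hτ h0 h1
  -- Translating the target chart moves the attaching point of `z` to `0` and keeps `∞`, so the
  -- product formula applies with `z` in place of `z₀`.
  obtain ⟨g, hg, hgi⟩ := exists_smul_sub (toC (τ (C.target.a _ z)))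
  obtain ⟨c', -, hc'⟩ := C.eq_prod_leaves hY v (z₀ := z) (z₁ := z₁) hσ hfin
    ((C.target.sphere _).trans_moebius_mem hτ g)
    (by
      rw [Homeomorph.trans_apply, moebius_apply, ← coe_toC hz, hg, sub_self])
    (by rw [Homeomorph.trans_apply, moebius_apply, h1, hgi])
  refine ⟨c, c', fun x hx => ⟨hc x hx, ?_⟩⟩
  have h2 := hc' x hx
  rw [Homeomorph.trans_apply, moebius_apply, hc x hx, hg] at h2
  exact OnePoint.coe_injective h2

/-- Eliminating `c'` from the two relations gives `c * (G₀ * H₁ - G₁ * H₀) = H₁ - H₀`. The limit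
determinant is nonzero because the limit function takes different values at the two points. -/
theorem tendsto_coeff {c c' G₀ G₁ H₀ H₁ : ℕ → ℂ} {γ γ' g₀ g₁ h₀ h₁ : ℂ}
    (hG₀ : Tendsto G₀ atTop (𝓝 g₀)) (hG₁ : Tendsto G₁ atTop (𝓝 g₁))
    (hH₀ : Tendsto H₀ atTop (𝓝 h₀)) (hH₁ : Tendsto H₁ atTop (𝓝 h₁))
    (e₀ : ∀ᶠ n in atTop, c n * G₀ n - 1 = c' n * H₀ n)
    (e₁ : ∀ᶠ n in atTop, c n * G₁ n - 1 = c' n * H₁ n)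
    (l₀ : γ * g₀ - 1 = γ' * h₀) (l₁ : γ * g₁ - 1 = γ' * h₁) (hne : γ * g₀ ≠ γ * g₁) :
    Tendsto c atTop (𝓝 γ) := by
  have hh : h₁ - h₀ ≠ 0 := fun h => hne (by linear_combination l₀ - l₁ - γ' * h)
  have hγ : γ * (g₀ * h₁ - g₁ * h₀) = h₁ - h₀ := by linear_combination h₁ * l₀ - h₀ * l₁
  have hΔ : g₀ * h₁ - g₁ * h₀ ≠ 0 := fun h => hh (by rw [← hγ, h, mul_zero])
  have hlim : Tendsto (fun n => G₀ n * H₁ n - G₁ n * H₀ n) atTop (𝓝 (g₀ * h₁ - g₁ * h₀)) :=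
    (hG₀.mul hH₁).sub (hG₁.mul hH₀)
  have h := (hH₁.sub hH₀).div hlim hΔ
  rw [← hγ, mul_div_cancel_right₀ _ hΔ] at h
  refine h.congr' ?_
  filter_upwards [e₀, e₁, hlim.eventually_ne hΔ] with n h0 h1 h2
  rw [Pi.div_apply, div_eq_iff h2]
  linear_combination H₀ n * h1 - H₁ n * h0

/-- The difference of the two relations determines `c'`, as the limit values differ; then `ζ = F₀ -
c' * H₀`. -/
theorem tendsto_shift {F₀ F₁ H₀ H₁ c' ζ : ℕ → ℂ} {f₀ f₁ h₀ h₁ γ' ζ' : ℂ}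
    (hF₀ : Tendsto F₀ atTop (𝓝 f₀)) (hF₁ : Tendsto F₁ atTop (𝓝 f₁))
    (hH₀ : Tendsto H₀ atTop (𝓝 h₀)) (hH₁ : Tendsto H₁ atTop (𝓝 h₁))
    (e₀ : ∀ᶠ n in atTop, F₀ n - ζ n = c' n * H₀ n)
    (e₁ : ∀ᶠ n in atTop, F₁ n - ζ n = c' n * H₁ n)
    (l₀ : f₀ - ζ' = γ' * h₀) (l₁ : f₁ - ζ' = γ' * h₁) (hne : f₀ ≠ f₁) :
    Tendsto ζ atTop (𝓝 ζ') := by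
  have hh : h₀ - h₁ ≠ 0 := fun h => hne (by linear_combination l₀ - l₁ + γ' * h)
  have hγ : f₀ - f₁ = γ' * (h₀ - h₁) := by linear_combination l₀ - l₁
  have hlim : Tendsto (fun n => H₀ n - H₁ n) atTop (𝓝 (h₀ - h₁)) := hH₀.sub hH₁
  have hc : Tendsto c' atTop (𝓝 γ') := by
    have h := (hF₀.sub hF₁).div hlim hh
    rw [hγ, mul_div_cancel_right₀ _ hh] at h
    refine h.congr' ?_
    filter_upwards [e₀, e₁, hlim.eventually_ne hh] with n h0 h1 h2
    rw [Pi.div_apply, div_eq_iff h2]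
    linear_combination h0 - h1
  have h := hF₀.sub (hc.mul hH₀)
  have hζ : f₀ - γ' * h₀ = ζ' := by linear_combination l₀
  rw [hζ] at h
  refine h.congr' ?_
  filter_upwards [e₀] with n h0
  linear_combination h0

namespace SphereCover

theorem toward_center (f : SphereCover.{u, v, w} P) (hY : 3 ≤ Fintype.card Y) (y : Y) :
    (f.source.toward f.center y).1 = Sum.inl y := by
  obtain ⟨v, hv⟩ := f.source.exists_adj_leaf hY y
  rw [f.source_unique v] at hv
  rw [f.source.toward_eq_iff _ _ hv.symm]
  exact self_mem_branch Sum.inr_ne_inl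

theorem attachSet_center (f : SphereCover.{u, v, w} P) (hY : 3 ≤ Fintype.card Y) :
    f.source.attachSet f.center = range f.aY := by
  refine Subset.antisymm ?_ ?_
  · rintro _ ⟨⟨p, hp⟩, rfl⟩
    cases p with
    | inl y => exact ⟨y, congrArg _ (Subtype.ext (f.toward_center hY y))⟩
    | inr v =>
      rw [f.source_unique v] at hp
      exact absurd hp (SimpleGraph.irrefl _)
  · rintro _ ⟨y, rfl⟩
    exact ⟨_, rfl⟩

theorem aZ_injective [Fintype Z] (f : SphereCover.{u, v, w} P) (hZ : 3 ≤ Fintype.card Z) :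
    Function.Injective f.aZ := fun z z' h => by
  have key : ∀ z, (f.target.toward (f.cover.vertexMap f.center) z).1 = Sum.inl z := fun z => by
    obtain ⟨v, hv⟩ := f.target.exists_adj_leaf hZ z
    rw [f.target_unique v] at hv
    rw [f.target.toward_eq_iff _ _ hv.symm]
    exact self_mem_branch Sum.inr_ne_inl
  have := congrArg Subtype.val (f.target.attach_injective _ h)
  rw [key, key] at this
  exact Sum.inl_injective this

end SphereCover

section Limit

variable {f : ℕ → SphereCover.{u, v, w} P} {C : MarkedCover.{u, v, w} P} {v : C.source.IV}
  {φY : ∀ n, (f n).sphereY ≃ₜ C.source.sphere v}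
  {φZ : ∀ n, (f n).sphereZ ≃ₜ C.target.sphere (C.cover.vertexMap v)}

theorem tendsto_toC_marking (haY : ∀ y, Tendsto (fun n => φY n ((f n).aY y)) atTop (𝓝 (C.source.a v y)))
    {σ : C.source.sphere v ≃ₜ RSphere}
    (hfin : ∀ x ∈ C.source.attachSet v, σ x ≠ OnePoint.infty) (y : Y) :
    Tendsto (fun n => toC (σ (φY n ((f n).aY y)))) atTop (𝓝 (toC (σ (C.source.a v y)))) :=
  (continuousAt_toC (hfin _ ⟨_, rfl⟩)).tendsto.comp ((σ.continuous.tendsto _).comp (haY y))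

/-- For large `n` the marked points avoid `∞` in the fixed chart `σ`, like their limits. The
formulas of `exists_forms` then hold for `f_n`, whose attaching points are exactly its markings. -/
theorem eventually_forms [Fintype Z] (hY : 3 ≤ Fintype.card Y) (hZ : 3 ≤ Fintype.card Z)
    (hφY : ∀ n, IsProjIso (φY n)) (hφZ : ∀ n, IsProjIso (φZ n))
    (haY : ∀ y, Tendsto (fun n => φY n ((f n).aY y)) atTop (𝓝 (C.source.a v y)))
    {σ : C.source.sphere v ≃ₜ RSphere} (hσ : σ ∈ (C.source.sphere v).charts)
    (hfin : ∀ x ∈ C.source.attachSet v, σ x ≠ OnePoint.infty)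
    {τ : C.target.sphere (C.cover.vertexMap v) ≃ₜ RSphere}
    (hτ : τ ∈ (C.target.sphere (C.cover.vertexMap v)).charts) {z₀ z₁ z : Z}
    (h0 : ∀ n, τ (φZ n ((f n).aZ z₀)) = ((0 : ℂ) : OnePoint ℂ))
    (h1 : ∀ n, τ (φZ n ((f n).aZ z₁)) = OnePoint.infty) (hz : z ≠ z₁) :
    ∃ c c' : ℕ → ℂ, ∀ᶠ n in atTop, ∀ x : ℂ, (∀ y, x ≠ toC (σ (φY n ((f n).aY y)))) →
      τ (φZ n ((f n).map ((φY n).symm (σ.symm x)))) =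
        ((c n * leafProd P z₀ z₁ (fun y => toC (σ (φY n ((f n).aY y)))) x : ℂ) : OnePoint ℂ) ∧
      c n * leafProd P z₀ z₁ (fun y => toC (σ (φY n ((f n).aY y)))) x -
          toC (τ (φZ n ((f n).aZ z))) =
        c' n * leafProd P z z₁ (fun y => toC (σ (φY n ((f n).aY y)))) x := by
  have hev : ∀ᶠ n in atTop, ∀ y, σ (φY n ((f n).aY y)) ≠ OnePoint.infty := by
    rw [eventually_all]
    exact fun y => ((σ.continuous.tendsto _).comp (haY y)).eventually_ne (hfin _ ⟨_, rfl⟩)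
  have key : ∀ᶠ n in atTop, ∃ d : ℂ × ℂ, ∀ x : ℂ, (∀ y, x ≠ toC (σ (φY n ((f n).aY y)))) →
      τ (φZ n ((f n).map ((φY n).symm (σ.symm x)))) =
        ((d.1 * leafProd P z₀ z₁ (fun y => toC (σ (φY n ((f n).aY y)))) x : ℂ) : OnePoint ℂ) ∧
      d.1 * leafProd P z₀ z₁ (fun y => toC (σ (φY n ((f n).aY y)))) x -
          toC (τ (φZ n ((f n).aZ z))) =
        d.2 * leafProd P z z₁ (fun y => toC (σ (φY n ((f n).aY y)))) x := by
    filter_upwards [hev] with n hn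
    obtain ⟨c, c', h⟩ := (f n).toMarkedCover.exists_forms hY (f n).center (z₀ := z₀) (z₁ := z₁) (z := z)
      (σ := (φY n).trans σ) (hφY n σ hσ)
      (by
        rw [(f n).attachSet_center hY]
        rintro _ ⟨y, rfl⟩
        exact hn y) (τ := (φZ n).trans τ) (hφZ n τ hτ) (h0 n) (h1 n)
      (by
        intro h
        refine hz ((f n).aZ_injective hZ ((φZ n).injective (τ.injective ?_)))
        rw [h1 n]
        exact h)
    refine ⟨(c, c'), fun x hx => h x ?_⟩
    rw [(f n).attachSet_center hY]
    rintro ⟨y, hy⟩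
    refine hx y ?_
    have : σ (φY n ((f n).aY y)) = (x : OnePoint ℂ) := by
      rw [hy]
      exact ((φY n).trans σ).apply_symm_apply x
    rw [this, toC_coe]
  obtain ⟨d, hd⟩ := key.choice
  exact ⟨fun n => (d n).1, fun n => (d n).2, hd⟩

end Limit

end

/-! ### Limits of the maps and of the target markings. -/

section

variable {Y Z : Type u} [Fintype Y] [DecidableEq Z] {P : Portrait Y Z}

theorem TreeOfSpheres.a_mem_attachSet {X : Type u} (T : TreeOfSpheres.{u, v, w} X) (v : T.IV)
    (x : X) : T.a v x ∈ T.attachSet v := ⟨_, rfl⟩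

section Limit

variable {f : ℕ → SphereCover.{u, v, w} P} {C : MarkedCover.{u, v, w} P} {v : C.source.IV}
  {φY : ∀ n, (f n).sphereY ≃ₜ C.source.sphere v}
  {φZ : ∀ n, (f n).sphereZ ≃ₜ C.target.sphere (C.cover.vertexMap v)}

/-- `f_n` and `f_v` are constants times the same `leafProd`, so only the constant needs an argument.
The limit is taken jointly in the index and the point, which is what local uniformity demands. -/
theorem tendsto_map_chart [Fintype Z] (hY : 3 ≤ Fintype.card Y) (hZ : 3 ≤ Fintype.card Z)
    (hφY : ∀ n, IsProjIso (φY n)) (hφZ : ∀ n, IsProjIso (φZ n))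
    (haY : ∀ y, Tendsto (fun n => φY n ((f n).aY y)) atTop (𝓝 (C.source.a v y)))
    {τ : C.target.sphere (C.cover.vertexMap v) ≃ₜ RSphere}
    {z₀ z₁ zi : Z} (hτ : IsTChart C.target z₀ z₁ zi _ τ)
    (h0 : ∀ n, φZ n ((f n).aZ z₀) = C.target.a _ z₀)
    (h1 : ∀ n, φZ n ((f n).aZ z₁) = C.target.a _ z₁)
    (hi : ∀ n, φZ n ((f n).aZ zi) = C.target.a _ zi)
    {x₀ : C.source.sphere v} (hx₀ : x₀ ∉ C.source.attachSet v) :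
    Tendsto (fun p : ℕ × C.source.sphere v => τ (φZ p.1 ((f p.1).map ((φY p.1).symm p.2))))
      (atTop ×ˢ 𝓝 x₀) (𝓝 (τ (C.cover.map v x₀))) := by
  obtain ⟨hτc, t0, t1, ti⟩ := hτ
  obtain ⟨x₁, hx₁, hne⟩ := C.cover.exists_map_ne v x₀
  obtain ⟨σ, hσ, hfin⟩ := (C.source.sphere v).exists_chart_finite
    ((C.source.finite_attachSet v).union (Set.toFinite {x₀, x₁}))
  have hfin' : ∀ x ∈ C.source.attachSet v, σ x ≠ OnePoint.infty := fun x hx => hfin x (Or.inl hx)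
  have f0 : σ x₀ ≠ OnePoint.infty := hfin x₀ (Or.inr (by simp))
  have f1 : σ x₁ ≠ OnePoint.infty := hfin x₁ (Or.inr (by simp))
  have hco : ∀ x, σ x ≠ OnePoint.infty → σ.symm ((toC (σ x) : ℂ) : OnePoint ℂ) = x := fun x hx => by
    rw [coe_toC hx, Homeomorph.symm_apply_apply]
  have hηne : ∀ x ∉ C.source.attachSet v, σ x ≠ OnePoint.infty →
      ∀ y, toC (σ x) ≠ toC (σ (C.source.a v y)) := fun x hx hx' y h => by
    apply hx
    rw [← hco x hx', h, hco _ (hfin' _ (C.source.a_mem_attachSet v y))]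
    exact C.source.a_mem_attachSet v y
  have hη := tendsto_toC_marking haY hfin'
  have hz : z₁ ≠ zi := by
    rintro rfl
    rw [t1] at ti
    exact OnePoint.coe_ne_infty _ ti
  -- With `z₁` as third leaf, the subtracted value is `1` both for `f_n` and in the limit, which is
  -- the normalization `tendsto_coeff` relies on.
  obtain ⟨γ, γ', hC⟩ := C.exists_forms hY v hσ hfin' hτc t0 ti (z := z₁)
    (by rw [t1]; exact OnePoint.coe_ne_infty _)
  obtain ⟨c, c', hf⟩ := eventually_forms hY hZ hφY hφZ haY hσ hfin' hτc (z₀ := z₀) (z₁ := zi) (z := z₁)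
    (fun n => by rw [h0, t0]) (fun n => by rw [hi, ti]) hz
  simp only [h1, t1, toC_coe] at hC hf
  have hev : ∀ x ∉ C.source.attachSet v, σ x ≠ OnePoint.infty →
      ∀ᶠ n in atTop, ∀ y, toC (σ x) ≠ toC (σ (φY n ((f n).aY y))) := fun x hx hx' => by
    rw [eventually_all]
    exact fun y => ((hη y).eventually_ne (hηne x hx hx' y).symm).mono fun n h => h.symm
  have hC0 := hC (toC (σ x₀)) (by rwa [hco x₀ f0])
  have hC1 := hC (toC (σ x₁)) (by rwa [hco x₁ f1])
  rw [hco x₀ f0] at hC0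
  rw [hco x₁ f1] at hC1
  have hc : Tendsto c atTop (𝓝 γ) := by
    refine tendsto_coeff (c' := c') (tendsto_leafProd hη tendsto_const_nhds (hηne x₀ hx₀ f0))
      (tendsto_leafProd hη tendsto_const_nhds (hηne x₁ hx₁ f1))
      (tendsto_leafProd hη tendsto_const_nhds (hηne x₀ hx₀ f0))
      (tendsto_leafProd hη tendsto_const_nhds (hηne x₁ hx₁ f1)) ?_ ?_ hC0.2 hC1.2 ?_
    · filter_upwards [hf, hev x₀ hx₀ f0] with n hn hn'
      exact (hn _ hn').2
    · filter_upwards [hf, hev x₁ hx₁ f1] with n hn hn'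
      exact (hn _ hn').2
    · intro h
      apply hne
      apply τ.injective
      rw [hC0.1, hC1.1, h]
  have hσt : Tendsto (fun p : ℕ × C.source.sphere v => toC (σ p.2)) (atTop ×ˢ 𝓝 x₀)
      (𝓝 (toC (σ x₀))) :=
    (continuousAt_toC f0).tendsto.comp ((σ.continuous.tendsto _).comp tendsto_snd)
  have hηt : ∀ y, Tendsto (fun p : ℕ × C.source.sphere v => toC (σ (φY p.1 ((f p.1).aY y))))
      (atTop ×ˢ 𝓝 x₀) (𝓝 (toC (σ (C.source.a v y)))) := fun y => (hη y).comp tendsto_fst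
  rw [hC0.1]
  refine ((OnePoint.continuous_coe.tendsto _).comp ((hc.comp tendsto_fst).mul
    (tendsto_leafProd hηt hσt (hηne x₀ hx₀ f0)))).congr' ?_
  have e1 : ∀ᶠ p : ℕ × C.source.sphere v in atTop ×ˢ 𝓝 x₀,
      ∀ y, toC (σ p.2) ≠ toC (σ (φY p.1 ((f p.1).aY y))) := by
    rw [eventually_all]
    intro y
    have := (hσt.sub (hηt y)).eventually_ne (sub_ne_zero.2 (hηne x₀ hx₀ f0 y))
    exact this.mono fun p hp => sub_ne_zero.1 hp
  have e2 : ∀ᶠ p : ℕ × C.source.sphere v in atTop ×ˢ 𝓝 x₀, σ p.2 ≠ OnePoint.infty :=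
    ((σ.continuous.tendsto _).comp tendsto_snd).eventually_ne f0
  filter_upwards [tendsto_fst.eventually hf, e1, e2] with p h1 h2 h3
  have := (h1 _ h2).1
  rw [hco _ h3] at this
  exact this.symm

/-- The convergence of the map at two points is already known. In the relation between `f_n`, its
translate by the marked value of `z`, and `leafProd`, that value is then the only unknown besides a
multiplicative constant. -/
theorem tendsto_aZ_chart [Fintype Z] (hY : 3 ≤ Fintype.card Y) (hZ : 3 ≤ Fintype.card Z)
    (hφY : ∀ n, IsProjIso (φY n)) (hφZ : ∀ n, IsProjIso (φZ n))
    (haY : ∀ y, Tendsto (fun n => φY n ((f n).aY y)) atTop (𝓝 (C.source.a v y)))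
    {τ : C.target.sphere (C.cover.vertexMap v) ≃ₜ RSphere}
    {z₀ z₁ zi : Z} (hτ : IsTChart C.target z₀ z₁ zi _ τ)
    (h0 : ∀ n, φZ n ((f n).aZ z₀) = C.target.a _ z₀)
    (h1 : ∀ n, φZ n ((f n).aZ z₁) = C.target.a _ z₁)
    (hi : ∀ n, φZ n ((f n).aZ zi) = C.target.a _ zi)
    {z : Z} (hz : τ (C.target.a _ z) ≠ OnePoint.infty) :
    Tendsto (fun n => τ (φZ n ((f n).aZ z))) atTop (𝓝 (τ (C.target.a _ z))) := by
  have hlim := fun {x} => tendsto_map_chart (x₀ := x) hY hZ hφY hφZ haY hτ h0 h1 hi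
  obtain ⟨hτc, t0, t1, ti⟩ := hτ
  obtain ⟨x₀, hx₀, -⟩ := C.cover.exists_map_ne v (Classical.arbitrary _)
  obtain ⟨x₁, hx₁, hne⟩ := C.cover.exists_map_ne v x₀
  obtain ⟨σ, hσ, hfin⟩ := (C.source.sphere v).exists_chart_finite
    ((C.source.finite_attachSet v).union (Set.toFinite {x₀, x₁}))
  have hfin' : ∀ x ∈ C.source.attachSet v, σ x ≠ OnePoint.infty := fun x hx => hfin x (Or.inl hx)
  have f0 : σ x₀ ≠ OnePoint.infty := hfin x₀ (Or.inr (by simp))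
  have f1 : σ x₁ ≠ OnePoint.infty := hfin x₁ (Or.inr (by simp))
  have hco : ∀ x, σ x ≠ OnePoint.infty → σ.symm ((toC (σ x) : ℂ) : OnePoint ℂ) = x := fun x hx => by
    rw [coe_toC hx, Homeomorph.symm_apply_apply]
  have hηne : ∀ x ∉ C.source.attachSet v, σ x ≠ OnePoint.infty →
      ∀ y, toC (σ x) ≠ toC (σ (C.source.a v y)) := fun x hx hx' y h => by
    apply hx
    rw [← hco x hx', h, hco _ (hfin' _ (C.source.a_mem_attachSet v y))]
    exact C.source.a_mem_attachSet v y
  have hη := tendsto_toC_marking haY hfin'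
  have hzi : z ≠ zi := by
    rintro rfl
    exact hz ti
  obtain ⟨γ, γ', hC⟩ := C.exists_forms hY v hσ hfin' hτc t0 ti hz
  obtain ⟨c, c', hf⟩ := eventually_forms hY hZ hφY hφZ haY hσ hfin' hτc (z₀ := z₀) (z₁ := zi) (z := z)
    (fun n => by rw [h0, t0]) (fun n => by rw [hi, ti]) hzi
  have hev : ∀ x ∉ C.source.attachSet v, σ x ≠ OnePoint.infty →
      ∀ᶠ n in atTop, ∀ y, toC (σ x) ≠ toC (σ (φY n ((f n).aY y))) := fun x hx hx' => by
    rw [eventually_all]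
    exact fun y => ((hη y).eventually_ne (hηne x hx hx' y).symm).mono fun n h => h.symm
  have hC' : ∀ x ∉ C.source.attachSet v, σ x ≠ OnePoint.infty →
      τ (C.cover.map v x) ≠ OnePoint.infty ∧
      toC (τ (C.cover.map v x)) - toC (τ (C.target.a _ z)) =
        γ' * leafProd P z zi (fun y => toC (σ (C.source.a v y))) (toC (σ x)) := by
    intro x hx hx'
    have := hC (toC (σ x)) (by rwa [hco x hx'])
    rw [hco x hx'] at this
    rw [this.1, toC_coe]
    exact ⟨OnePoint.coe_ne_infty _, this.2⟩
  have hf' : ∀ x ∉ C.source.attachSet v, σ x ≠ OnePoint.infty → ∀ᶠ n in atTop,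
      toC (τ (φZ n ((f n).map ((φY n).symm x)))) - toC (τ (φZ n ((f n).aZ z))) =
        c' n * leafProd P z zi (fun y => toC (σ (φY n ((f n).aY y)))) (toC (σ x)) := by
    intro x hx hx'
    filter_upwards [hf, hev x hx hx'] with n hn hn'
    have := hn _ hn'
    rw [hco x hx'] at this
    rw [this.1, toC_coe]
    exact this.2
  have hval : ∀ x ∉ C.source.attachSet v, σ x ≠ OnePoint.infty →
      Tendsto (fun n => toC (τ (φZ n ((f n).map ((φY n).symm x))))) atTop
        (𝓝 (toC (τ (C.cover.map v x)))) := by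
    intro x hx hx'
    exact (continuousAt_toC (hC' x hx hx').1).tendsto.comp
      ((hlim hx).comp (tendsto_id.prodMk tendsto_const_nhds))
  have key : Tendsto (fun n => toC (τ (φZ n ((f n).aZ z)))) atTop (𝓝 (toC (τ (C.target.a _ z)))) := by
    refine tendsto_shift (hval x₀ hx₀ f0) (hval x₁ hx₁ f1)
      (tendsto_leafProd hη tendsto_const_nhds (hηne x₀ hx₀ f0))
      (tendsto_leafProd hη tendsto_const_nhds (hηne x₁ hx₁ f1))
      (hf' x₀ hx₀ f0) (hf' x₁ hx₁ f1) (hC' x₀ hx₀ f0).2 (hC' x₁ hx₁ f1).2 fun h => hne ?_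
    apply τ.injective
    rw [← coe_toC (hC' x₀ hx₀ f0).1, h, coe_toC (hC' x₁ hx₁ f1).1]
  rw [← coe_toC hz]
  -- Target markings of a sphere cover are injective, so the marked point of `z` is never at `∞`,
  -- which is occupied by `zi`, and `toC` loses nothing.
  refine ((OnePoint.continuous_coe.tendsto _).comp key).congr fun n => coe_toC fun h => hzi ?_
  refine (f n).aZ_injective hZ ((φZ n).injective (τ.injective ?_))
  rw [h, hi, ti]

/-- Exchanging `0` and `∞` by `x ↦ 1 / x` makes the leaves attached at `∞` accessible to
`tendsto_aZ_chart`. -/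
theorem isTChart_inv {X : Type u} {T : TreeOfSpheres.{u, v, w} X} {v : T.IV} {x₀ x₁ xi : X}
    {τ : T.sphere v ≃ₜ RSphere} (hτ : IsTChart T x₀ x₁ xi v τ) :
    ∃ τ', IsTChart T xi x₁ x₀ v τ' := by
  obtain ⟨hτc, t0, t1, ti⟩ := hτ
  obtain ⟨g, hg⟩ := exists_smul_inv
  refine ⟨_, (T.sphere v).trans_moebius_mem hτc g, ?_, ?_, ?_⟩
  · rw [Homeomorph.trans_apply, moebius_apply, ti, ← proj_zero_right 1, hg _ _ (by simp), ← proj_one]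
  · rw [Homeomorph.trans_apply, moebius_apply, t1, ← proj_one, hg _ _ (by simp)]
  · rw [Homeomorph.trans_apply, moebius_apply, t0, ← proj_one, hg _ _ (by simp), proj_zero_right]

theorem tendsto_aZ [Fintype Z] (hY : 3 ≤ Fintype.card Y) (hZ : 3 ≤ Fintype.card Z)
    (hφY : ∀ n, IsProjIso (φY n)) (hφZ : ∀ n, IsProjIso (φZ n))
    (haY : ∀ y, Tendsto (fun n => φY n ((f n).aY y)) atTop (𝓝 (C.source.a v y)))
    {τ : C.target.sphere (C.cover.vertexMap v) ≃ₜ RSphere}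
    {z₀ z₁ zi : Z} (hτ : IsTChart C.target z₀ z₁ zi _ τ)
    (h0 : ∀ n, φZ n ((f n).aZ z₀) = C.target.a _ z₀)
    (h1 : ∀ n, φZ n ((f n).aZ z₁) = C.target.a _ z₁)
    (hi : ∀ n, φZ n ((f n).aZ zi) = C.target.a _ zi) (z : Z) :
    Tendsto (fun n => φZ n ((f n).aZ z)) atTop (𝓝 (C.target.a _ z)) := by
  have conv : ∀ τ : C.target.sphere (C.cover.vertexMap v) ≃ₜ RSphere,
      Tendsto (fun n => τ (φZ n ((f n).aZ z))) atTop (𝓝 (τ (C.target.a _ z))) →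
      Tendsto (fun n => φZ n ((f n).aZ z)) atTop (𝓝 (C.target.a _ z)) := fun τ h =>
    τ.isInducing.tendsto_nhds_iff.2 h
  by_cases hz : τ (C.target.a _ z) = OnePoint.infty
  · obtain ⟨τ', hτ'⟩ := isTChart_inv hτ
    refine conv τ' (tendsto_aZ_chart hY hZ hφY hφZ haY hτ' hi h1 h0 ?_)
    have : C.target.a (C.cover.vertexMap v) z = C.target.a _ zi :=
      τ.injective (hz.trans hτ.2.2.2.symm)
    rw [this, hτ'.2.1]
    exact OnePoint.coe_ne_infty _
  · exact conv τ (tendsto_aZ_chart hY hZ hφY hφZ haY hτ h0 h1 hi hz)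

theorem locallyUniformLimit_of_tendsto_aY [Fintype Z] (hY : 3 ≤ Fintype.card Y)
    (hZ : 3 ≤ Fintype.card Z)
    (hφY : ∀ n, IsProjIso (φY n)) (hφZ : ∀ n, IsProjIso (φZ n))
    (haY : ∀ y, Tendsto (fun n => φY n ((f n).aY y)) atTop (𝓝 (C.source.a v y)))
    {τ : C.target.sphere (C.cover.vertexMap v) ≃ₜ RSphere}
    {z₀ z₁ zi : Z} (hτ : IsTChart C.target z₀ z₁ zi _ τ)
    (h0 : ∀ n, φZ n ((f n).aZ z₀) = C.target.a _ z₀)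
    (h1 : ∀ n, φZ n ((f n).aZ z₁) = C.target.a _ z₁)
    (hi : ∀ n, φZ n ((f n).aZ zi) = C.target.a _ zi) :
    LocallyUniformLimit (fun n x => φZ n ((f n).map ((φY n).symm x))) (C.cover.map v)
      (C.source.attachSet v)ᶜ := by
  let _ : UniformSpace (C.target.sphere (C.cover.vertexMap v)) := uniformSpaceOfCompactR1
  unfold LocallyUniformLimit
  rw [(C.source.finite_attachSet v).isClosed.isOpen_compl.tendstoLocallyUniformlyOn_iff_forall_tendsto]
  intro x hx
  have key := tendsto_map_chart hY hZ hφY hφZ haY hτ h0 h1 hi hx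
  have h2 : Tendsto (fun p : ℕ × C.source.sphere v => φZ p.1 ((f p.1).map ((φY p.1).symm p.2)))
      (atTop ×ˢ 𝓝 x) (𝓝 (C.cover.map v x)) := τ.isInducing.tendsto_nhds_iff.2 key
  have h3 : Tendsto (fun p : ℕ × C.source.sphere v => C.cover.map v p.2)
      (atTop ×ˢ 𝓝 x) (𝓝 (C.cover.map v x)) :=
    ((C.cover.holomorphic v).continuous.tendsto x).comp tendsto_snd
  -- Both the maps `f_n` and the continuous map `f_v` tend to `f_v x` along the product filter,
  -- hence they are eventually uniformly close to each other.
  exact (h3.prodMk_nhds h2).mono_right (nhds_le_uniformity _)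

end Limit

end

section

/-! ### Convergence of Moebius transformations -/

/-- A Moebius map is determined by the images of `0`, `1`, `∞`, and its inverse depends continuously
on them. These three limits force `g n` to tend to the identity, so `x n` and `g n • x n` have the
same limit. -/
theorem tendsto_of_tendsto_smul {g : ℕ → Matrix.GeneralLinearGroup (Fin 2) ℂ} {x : ℕ → RSphere}
    {y : RSphere}
    (h0 : Tendsto (fun n => g n • ((0 : ℂ) : OnePoint ℂ)) atTop (𝓝 ((0 : ℂ) : OnePoint ℂ)))
    (h1 : Tendsto (fun n => g n • ((1 : ℂ) : OnePoint ℂ)) atTop (𝓝 ((1 : ℂ) : OnePoint ℂ)))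
    (hi : Tendsto (fun n => g n • (OnePoint.infty : OnePoint ℂ)) atTop (𝓝 OnePoint.infty))
    (hy : Tendsto (fun n => g n • x n) atTop (𝓝 y)) : Tendsto x atTop (𝓝 y) := by
  have e0 : ∀ n, g n • ((0 : ℂ) : OnePoint ℂ) = proj (g n 0 1) (g n 1 1) := fun n => by
    rw [← proj_one, smul_proj _ (by simp)]
    simp
  have e1 : ∀ n, g n • ((1 : ℂ) : OnePoint ℂ) = proj (g n 0 0 + g n 0 1) (g n 1 0 + g n 1 1) :=
    fun n => by
      rw [← proj_one, smul_proj _ (by simp)]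
      simp
  have ei : ∀ n, g n • (OnePoint.infty : OnePoint ℂ) = proj (g n 0 0) (g n 1 0) := fun n => by
    rw [← proj_zero_right 1, smul_proj _ (by simp)]
    simp
  have hβ : Tendsto (fun n => toC (g n • ((0 : ℂ) : OnePoint ℂ))) atTop (𝓝 0) := by
    simpa [Function.comp_def] using (continuousAt_toC (OnePoint.coe_ne_infty 0)).tendsto.comp h0
  have hδ : Tendsto (fun n => toC (g n • ((1 : ℂ) : OnePoint ℂ))) atTop (𝓝 1) := by
    simpa [Function.comp_def] using (continuousAt_toC (OnePoint.coe_ne_infty 1)).tendsto.comp h1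
  have hγ : Tendsto (fun n => coord OnePoint.infty (g n • (OnePoint.infty : OnePoint ℂ))) atTop
      (𝓝 0) := (tendsto_coord OnePoint.infty).comp hi
  set β : ℕ → ℂ := fun n => toC (g n • ((0 : ℂ) : OnePoint ℂ)) with hβd
  set δ : ℕ → ℂ := fun n => toC (g n • ((1 : ℂ) : OnePoint ℂ)) with hδd
  set γ : ℕ → ℂ := fun n => coord OnePoint.infty (g n • (OnePoint.infty : OnePoint ℂ)) with hγd
  have hden : Tendsto (fun n => 1 - γ n * δ n) atTop (𝓝 1) := by
    simpa using (tendsto_const_nhds (x := (1 : ℂ))).sub (hγ.mul hδ)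
  -- For `g = (a b; c d)` put `β = b / d`, `γ = c / a`, `δ = (a + b) / (c + d)`. Solving the last
  -- equation for `a / d` gives this quotient.
  have hlam : Tendsto (fun n => (δ n - β n) / (1 - γ n * δ n)) atTop (𝓝 1) := by
    simpa [Pi.div_def] using (hδ.sub hβ).div hden one_ne_zero
  set lam : ℕ → ℂ := fun n => (δ n - β n) / (1 - γ n * δ n) with hlamd
  have hs : Tendsto (fun n => coord y (g n • x n)) atTop (𝓝 0) := (tendsto_coord y).comp hy
  have hu : Tendsto (fun n => paramNum y (coord y (g n • x n))) atTop (𝓝 (paramNum y 0)) :=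
    ((continuous_paramNum y).tendsto 0).comp hs
  have hv : Tendsto (fun n => paramDen y (coord y (g n • x n))) atTop (𝓝 (paramDen y 0)) :=
    ((continuous_paramDen y).tendsto 0).comp hs
  -- The inverse of `g` sends `(u : w)` to `(d u - b w : a w - c u)`. Divided by `d`, this is `(u -
  -- β w : lam w - lam γ u)`, which tends to `(u : w)`.
  have hlim := tendsto_proj (hu.sub (hβ.mul hv)) ((hlam.mul hv).sub ((hlam.mul hγ).mul hu))
    (by simpa using param_ne y 0)
  have hlim' : proj (paramNum y 0 - 0 * paramDen y 0)
      (1 * paramDen y 0 - 1 * 0 * paramNum y 0) = y := by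
    simp only [zero_mul, sub_zero, one_mul, ← param_eq_proj, param_zero]
  rw [hlim'] at hlim
  refine hlim.congr' ?_
  filter_upwards [h0.eventually_ne (OnePoint.coe_ne_infty 0),
    h1.eventually_ne (OnePoint.coe_ne_infty 1), hi.eventually_ne (OnePoint.infty_ne_coe 0),
    hden.eventually_ne one_ne_zero, hy.eventually (eventually_param_coord y)] with n a0 a1 ai ad ay
  have hd : g n 1 1 ≠ 0 := fun h => a0 (by rw [e0, h, proj_zero_right])
  have hcd : g n 1 0 + g n 1 1 ≠ 0 := fun h => a1 (by rw [e1, h, proj_zero_right])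
  have hdet := det_ne (g n)
  have ha : g n 0 0 ≠ 0 := fun h => ai (by
    rw [ei, h, ← proj_one]
    refine proj_eq_proj (Or.inr fun h' => hdet ?_) (by simp) (by simp)
    rw [h, h']
    ring)
  have bβ : β n = g n 0 1 / g n 1 1 := by
    simp only [hβd, e0, proj_of_ne hd, toC_coe]
  have bδ : δ n = (g n 0 0 + g n 0 1) / (g n 1 0 + g n 1 1) := by
    simp only [hδd, e1, proj_of_ne hcd, toC_coe]
  have bγ : γ n = g n 1 0 / g n 0 0 := by
    simp only [hγd, ei, coord_proj_infty]
  have bl : lam n = g n 0 0 / g n 1 1 := by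
    rw [hlamd]
    simp only
    rw [div_eq_div_iff ad hd, bβ, bδ, bγ]
    field_simp
    ring
  set U := paramNum y (coord y (g n • x n))
  set W := paramDen y (coord y (g n • x n))
  have hUW : U ≠ 0 ∨ W ≠ 0 := param_ne _ _
  have hne : U - β n * W ≠ 0 ∨ lam n * W - lam n * γ n * U ≠ 0 := by
    by_contra! hc
    rw [bβ, bl, bγ] at hc
    have c1 : g n 1 1 * U - g n 0 1 * W = 0 := by
      have := hc.1
      field_simp at this
      linear_combination this
    have c2 : g n 0 0 * W - g n 1 0 * U = 0 := by
      have := hc.2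
      field_simp at this
      linear_combination this
    have d1 : (g n 0 0 * g n 1 1 - g n 0 1 * g n 1 0) * U = 0 := by
      linear_combination g n 0 0 * c1 + g n 0 1 * c2
    have d2 : (g n 0 0 * g n 1 1 - g n 0 1 * g n 1 0) * W = 0 := by
      linear_combination g n 1 0 * c1 + g n 1 1 * c2
    simp only [mul_eq_zero, hdet, false_or] at d1 d2
    simp [d1, d2] at hUW
  refine smul_left_cancel (g n) ?_
  rw [smul_proj _ hne]
  have hyy : g n • x n = proj U W := by rw [← param_eq_proj, ay]
  rw [hyy]
  refine proj_eq_proj (smul_ne _ hne) hUW ?_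
  rw [bβ, bl, bγ]
  field_simp
  ring

/-! ### Charts adapted to a triple -/

variable {X : Type u}

theorem exists_isTChart {T : TreeOfSpheres.{u, v, w} X} {v : T.IV} {x₀ x₁ xi : X}
    (h : T.Separates v x₀ x₁ xi) : ∃ σ, IsTChart T x₀ x₁ xi v σ := by
  have hinj := T.attach_injective v
  obtain ⟨σ, hσ, h0, h1, hi⟩ := (T.sphere v).exists_chart_three (hinj.ne h.1) (hinj.ne h.2.1)
    (hinj.ne h.2.2)
  exact ⟨σ, hσ, h0, h1, hi⟩

theorem IsTChart.separates {T : TreeOfSpheres.{u, v, w} X} {v : T.IV} {x₀ x₁ xi : X}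
    {σ : T.sphere v ≃ₜ RSphere} (h : IsTChart T x₀ x₁ xi v σ) : T.Separates v x₀ x₁ xi := by
  obtain ⟨-, h0, h1, hi⟩ := h
  refine ⟨fun h => ?_, fun h => ?_, fun h => ?_⟩
  · rw [TreeOfSpheres.a, h, ← TreeOfSpheres.a, h1] at h0
    exact one_ne_zero (OnePoint.coe_injective h0)
  · rw [TreeOfSpheres.a, h, ← TreeOfSpheres.a, hi] at h0
    exact OnePoint.infty_ne_coe _ h0
  · rw [TreeOfSpheres.a, h, ← TreeOfSpheres.a, hi] at h1
    exact OnePoint.infty_ne_coe _ h1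

/-- Separating vertex and normalized chart are unique, so the choice hidden in `tMarking` is
harmless. -/
theorem tMarking_eq {T : TreeOfSpheres.{u, v, w} X} {v : T.IV} {x₀ x₁ xi : X}
    {σ : T.sphere v ≃ₜ RSphere} (h : IsTChart T x₀ x₁ xi v σ) (x : X) :
    tMarking T x₀ x₁ xi x = σ (T.a v x) := by
  have hex : ∃ s, ∃ v σ, IsTChart T x₀ x₁ xi v σ ∧ σ (T.a v x) = s := ⟨_, v, σ, h, rfl⟩
  obtain ⟨v', σ', h', hs⟩ := Classical.epsilon_spec hex
  change σ' (T.a v' x) = tMarking T x₀ x₁ xi x at hs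
  obtain rfl := T.separates_unique h'.separates h.separates
  obtain ⟨g, hg⟩ := (T.sphere v').exists_smul_chart h.1 h'.1
  rw [← hs, hg]
  have h0 := hg (T.a v' x₀)
  have h1 := hg (T.a v' x₁)
  have hi := hg (T.a v' xi)
  rw [h.2.1, h'.2.1] at h0
  rw [h.2.2.1, h'.2.2.1] at h1
  rw [h.2.2.2, h'.2.2.2] at hi
  -- The constant-sequence case of `tendsto_of_tendsto_smul`: a Moebius map fixing `0`, `1` and `∞`
  -- is the identity.
  refine tendsto_nhds_unique (tendsto_const_nhds (f := (atTop : Filter ℕ)))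
    (tendsto_of_tendsto_smul (g := fun _ => g) ?_ ?_ ?_ ?_) |>.symm
  · rw [← h0]; exact tendsto_const_nhds
  · rw [← h1]; exact tendsto_const_nhds
  · rw [← hi]; exact tendsto_const_nhds
  · exact tendsto_const_nhds

theorem isProjIso_trans_symm {S S' : ProjSphere.{w}} {σ : S ≃ₜ RSphere} (hσ : σ ∈ S.charts)
    {τ : S' ≃ₜ RSphere} (hτ : τ ∈ S'.charts) : IsProjIso (σ.trans τ.symm) := by
  intro ρ hρ
  obtain ⟨g, hg⟩ := S'.exists_smul_chart hτ hρ
  refine (S.mem_charts_iff σ hσ _).2 ⟨g, fun x => ?_⟩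
  simp [hg]

theorem ModBar.tendsto_iff {X : Type u} {c : ℕ → ModBar.{u, v, w} X} {c₀ : ModBar.{u, v, w} X} :
    Tendsto c atTop (𝓝 c₀) ↔
    ∀ q, Tendsto (fun n => crossRatios X (c n) q) atTop (𝓝 (crossRatios X c₀ q)) := by
  have : IsInducing (crossRatios.{u, v, w} X) := ⟨rfl⟩
  rw [this.tendsto_nhds_iff, tendsto_pi_nhds]
  rfl

/-! ### The two implications. -/

variable {Y Z : Type u} [Fintype Y] [DecidableEq Z] {P : Portrait Y Z}

theorem SphereCover.exists_isTChart_source (f : SphereCover.{u, v, w} P) (hY : 3 ≤ Fintype.card Y)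
    {x₀ x₁ xi : Y} (h01 : x₀ ≠ x₁) (h0i : x₀ ≠ xi) (h1i : x₁ ≠ xi) :
    ∃ σ, IsTChart f.source x₀ x₁ xi f.center σ := by
  obtain ⟨v, hv⟩ := f.source.exists_separating hY h01 h0i h1i
  rw [f.source_unique v] at hv
  exact exists_isTChart hv

theorem SphereCover.exists_isTChart_target [Fintype Z] (f : SphereCover.{u, v, w} P)
    (hZ : 3 ≤ Fintype.card Z) {x₀ x₁ xi : Z} (h01 : x₀ ≠ x₁) (h0i : x₀ ≠ xi) (h1i : x₁ ≠ xi) :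
    ∃ σ, IsTChart f.target x₀ x₁ xi (f.cover.vertexMap f.center) σ := by
  obtain ⟨v, hv⟩ := f.target.exists_separating hZ h01 h0i h1i
  rw [f.target_unique v] at hv
  exact exists_isTChart hv

theorem ConvergesTo.tendsto_I {f : ℕ → SphereCover.{u, v, w} P} {C : MarkedCover.{u, v, w} P}
    (hY : 3 ≤ Fintype.card Y) (h : ConvergesTo f C) :
    Tendsto (fun n => RevBar.I (f n).toMarkedCover.cls) atTop (𝓝 (RevBar.I C.cls)) := by
  obtain ⟨φY, φZ, hφY, -, h⟩ := h
  refine ModBar.tendsto_iff.2 fun q => ?_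
  change Tendsto (fun n => tMarking (f n).source (q.1 0) (q.1 1) (q.1 2) (q.1 3)) atTop
    (𝓝 (tMarking C.source (q.1 0) (q.1 1) (q.1 2) (q.1 3)))
  have hq : ∀ i j, i ≠ j → q.1 i ≠ q.1 j := fun i j hij => q.2.ne hij
  obtain ⟨v, hv⟩ := C.source.exists_separating hY (hq 0 1 (by decide)) (hq 0 2 (by decide))
    (hq 1 2 (by decide))
  obtain ⟨σ, hσ⟩ := exists_isTChart hv
  choose σ' hσ' using fun n => (f n).exists_isTChart_source hY (hq 0 1 (by decide))
    (hq 0 2 (by decide)) (hq 1 2 (by decide))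
  simp only [tMarking_eq hσ, tMarking_eq (hσ' _)]
  -- The Moebius map `g n` compares the normalized chart of the n-th source with the limit chart
  -- read through `φY`. Convergence of the markings of the triple says that it nearly fixes `0`, `1`
  -- and `∞`.
  choose g hg using fun n => ((f n).source.sphere (f n).center).exists_smul_chart (hσ' n).1
    (hφY n v σ hσ.1)
  have hlim : ∀ y, Tendsto (fun n => g n • σ' n ((f n).source.a (f n).center y)) atTop
      (𝓝 (σ (C.source.a v y))) := fun y => by
    simp only [← hg]
    exact (σ.continuous.tendsto _).comp ((h v).1 y)
  refine tendsto_of_tendsto_smul (g := g) ?_ ?_ ?_ (hlim _)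
  · have := hlim (q.1 0)
    simpa only [hσ.2.1, (hσ' _).2.1] using this
  · have := hlim (q.1 1)
    simpa only [hσ.2.2.1, (hσ' _).2.2.1] using this
  · have := hlim (q.1 2)
    simpa only [hσ.2.2.2, (hσ' _).2.2.2] using this

/-- The isomorphisms are built from normalized charts of one separating triple per vertex, for
source and target separately. They place the markings of each triple exactly at their limits, as the
lemmas on maps and target markings require. -/
theorem convergesTo_of_tendsto_I [Fintype Z] {f : ℕ → SphereCover.{u, v, w} P}
    {C : MarkedCover.{u, v, w} P} (hY : 3 ≤ Fintype.card Y) (hZ : 3 ≤ Fintype.card Z)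
    (h : Tendsto (fun n => RevBar.I (f n).toMarkedCover.cls) atTop (𝓝 (RevBar.I C.cls))) :
    ConvergesTo f C := by
  replace h : ∀ q : Quad Y,
      Tendsto (fun n => tMarking (f n).source (q.1 0) (q.1 1) (q.1 2) (q.1 3)) atTop
        (𝓝 (tMarking C.source (q.1 0) (q.1 1) (q.1 2) (q.1 3))) := ModBar.tendsto_iff.1 h
  choose y₀ y₁ yi hy using C.source.exists_separates
  choose z₀ z₁ zi hz using C.target.exists_separates
  choose σ hσ using fun v => exists_isTChart (hy v)
  choose τ hτ using fun w => exists_isTChart (hz w)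
  choose σ' hσ' using fun n v => (f n).exists_isTChart_source hY
    (fun h => (hy v).1 (congrArg _ h)) (fun h => (hy v).2.1 (congrArg _ h))
    (fun h => (hy v).2.2 (congrArg _ h))
  choose τ' hτ' using fun n w => (f n).exists_isTChart_target hZ
    (fun h => (hz w).1 (congrArg _ h)) (fun h => (hz w).2.1 (congrArg _ h))
    (fun h => (hz w).2.2 (congrArg _ h))
  have hφY : ∀ n v, IsProjIso ((σ' n v).trans (σ v).symm) := fun n v =>
    isProjIso_trans_symm (hσ' n v).1 (hσ v).1
  have hφZ : ∀ n w, IsProjIso ((τ' n w).trans (τ w).symm) := fun n w =>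
    isProjIso_trans_symm (hτ' n w).1 (hτ w).1
  have haY : ∀ v y, Tendsto (fun n => (σ v).symm (σ' n v ((f n).aY y))) atTop
      (𝓝 (C.source.a v y)) := by
    intro v y
    have key : Tendsto (fun n => σ' n v ((f n).aY y)) atTop (𝓝 (σ v (C.source.a v y))) := by
      -- The map to cross-ratios only records quadruples of distinct leaves, so the three leaves of
      -- the triple are treated apart; their images are constantly `0`, `1`, `∞`.
      by_cases c0 : y = y₀ v
      · subst c0
        rw [(hσ v).2.1]
        exact tendsto_const_nhds.congr fun n => (hσ' n v).2.1.symm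
      by_cases c1 : y = y₁ v
      · subst c1
        rw [(hσ v).2.2.1]
        exact tendsto_const_nhds.congr fun n => (hσ' n v).2.2.1.symm
      by_cases ci : y = yi v
      · subst ci
        rw [(hσ v).2.2.2]
        exact tendsto_const_nhds.congr fun n => (hσ' n v).2.2.2.symm
      have hinj : Function.Injective ![y₀ v, y₁ v, yi v, y] := by
        have n1 : y₀ v ≠ y₁ v := fun h => (hy v).1 (congrArg _ h)
        have n2 : y₀ v ≠ yi v := fun h => (hy v).2.1 (congrArg _ h)
        have n3 : y₁ v ≠ yi v := fun h => (hy v).2.2 (congrArg _ h)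
        intro i j hij
        fin_cases i <;> fin_cases j <;> simp_all [eq_comm]
      have := h ⟨_, hinj⟩
      simp only [tMarking_eq (hσ v), tMarking_eq (hσ' _ v), Matrix.cons_val] at this
      exact this
    have := ((σ v).symm.continuous.tendsto _).comp key
    rwa [Homeomorph.symm_apply_apply] at this
  have hZ' : ∀ n w, (τ w).symm (τ' n w ((f n).aZ (z₀ w))) = C.target.a w (z₀ w) ∧
      (τ w).symm (τ' n w ((f n).aZ (z₁ w))) = C.target.a w (z₁ w) ∧
      (τ w).symm (τ' n w ((f n).aZ (zi w))) = C.target.a w (zi w) := fun n w => by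
    simp only [Homeomorph.symm_apply_eq, hτ w |>.2.1, hτ w |>.2.2.1, hτ w |>.2.2.2]
    exact (hτ' n w).2
  refine ⟨fun n v => (σ' n v).trans (σ v).symm, fun n w => (τ' n w).trans (τ w).symm, hφY, hφZ,
    fun v => ⟨haY v, ?_, ?_⟩⟩
  · exact tendsto_aZ (φY := fun n => (σ' n v).trans (σ v).symm)
      (φZ := fun n => (τ' n _).trans (τ _).symm) hY hZ (fun n => hφY n v) (fun n => hφZ n _)
      (haY v) (hτ _) (fun n => (hZ' n _).1) (fun n => (hZ' n _).2.1) (fun n => (hZ' n _).2.2)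
  · exact locallyUniformLimit_of_tendsto_aY (φY := fun n => (σ' n v).trans (σ v).symm)
      (φZ := fun n => (τ' n _).trans (τ _).symm) hY hZ (fun n => hφY n v) (fun n => hφZ n _)
      (haY v) (hτ _) (fun n => (hZ' n _).1) (fun n => (hZ' n _).2.1) (fun n => (hZ' n _).2.2)

end

end

end SphereTrees

theorem mainTheorem7 {Y Z : Type u} [Fintype Y] [Fintype Z] [DecidableEq Z]
    (hY : 3 ≤ Fintype.card Y) (hZ : 3 ≤ Fintype.card Z)
    (P : SphereTrees.Portrait Y Z)
    (f : ℕ → SphereTrees.SphereCover.{u, v, w} P)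
    (C : SphereTrees.MarkedCover.{u, v, w} P) :
    (SphereTrees.ConvergesTo f C ↔
      Tendsto (fun n => (f n).toMarkedCover.cls) atTop (𝓝 C.cls)) ∧
    (SphereTrees.ConvergesTo f C ↔
      Tendsto (fun n => SphereTrees.RevBar.I (f n).toMarkedCover.cls) atTop
        (𝓝 (SphereTrees.RevBar.I C.cls))) := by
  have h : SphereTrees.ConvergesTo f C ↔
      Tendsto (fun n => SphereTrees.RevBar.I (f n).toMarkedCover.cls) atTop
        (𝓝 (SphereTrees.RevBar.I C.cls)) :=
    ⟨fun h => h.tendsto_I hY, fun h => SphereTrees.convergesTo_of_tendsto_I hY hZ h⟩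
  have hI : IsInducing (SphereTrees.RevBar.I (P := P)) := ⟨rfl⟩
  exact ⟨h.trans hI.tendsto_nhds_iff.symm, h⟩
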